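/- **Theorem 3.1 (Lower bound).** Let $d\in\{1,2,3\}$, let $\Omega\subset\mathbb R^d$ be a non-empty bounded open convex set, and let $\mathcal T_h$ be a geometrically conforming simplicial mesh of $\Omega$: a finite set of non-degenerate closed $d$-simplices whose union is $\overline\Omega$ and any two of which intersect in the (possibly empty) common face spanned by their common vertices. Let $h:=\max_{K\in\mathcal T_h}\operatorname{diam}K$. Let $\kappa>0$, and let $V\in L^\infty(\Omega)$, $V\ge 0$, be $\mathcal T_h$-piecewise constant. All functions are real-valued, and $(\cdot,\cdot)_{L^2}$ denotes the inner product of $L^2(\Omega)$ or $L^2(\Omega)^d$. Let $$E:=\min\Big\{\tfrac12\|\nabla v\|_{L^2}^2+\tfrac12(Vv,v)_{L^2}+\tfrac{\kappa}{4}\|v\|_{L^4}^4\;:\;v\in H^1_0(\Omega),\ \|v\|_{L^2}=1\Big\}$$ be the Gross–Pitaevskii ground-state energy. Let $U_h$ be the space of $\mathcal T_h$-piecewise constant functions and $$\Sigma_h:=\{\tau\in H(\operatorname{div},\Omega)\;:\;\forall K\in\mathcal T_h\ \exists a\in\mathbb R^d,\,b\in\mathbb R:\ \tau(x)=a+bx\text{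 for a.e. }x\in K\}$$ the lowest-order Raviart–Thomas space. For $v_h\in U_h$ define $G_hv_h\in\Sigma_h$ by $$(G_hv_h,\tau_h)_{L^2}+(\operatorname{div}\tau_h,v_h)_{L^2}=0\qquad\text{for all }\tau_h\in\Sigma_h,$$ and let $$E_h:=\min\Big\{\tfrac12\|G_hv_h\|_{L^2}^2+\tfrac12(Vv_h,v_h)_{L^2}+\tfrac{\kappa}{4}\|v_h\|_{L^4}^4\;:\;v_h\in U_h,\ \|v_h\|_{L^2}=1\Big\}$$ be the discrete ground-state energy. Then $$\frac{E_h}{1+4h^2\pi^{-2}E_h}\le E .$$ -/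

import Mathlib

open MeasureTheory Filter Topology
open scoped ENNReal ContDiff

namespace GrossPitaevskii

noncomputable section

/-- The Euclidean space `ℝ^d`. -/
abbrev Space (d : ℕ) : Type := EuclideanSpace ℝ (Fin d)

/-! ### Sobolev spaces -/

/-- `φ ∈ C_c^∞(Ω)`: a real test function on `Ω`. -/
def IsTestFunction {d : ℕ} (Ω : Set (Space d)) (φ : Space d → ℝ) : Prop :=
  ContDiff ℝ ∞ φ ∧ HasCompactSupport φ ∧ tsupport φ ⊆ Ω

/-- `g ∈ L²(Ω)^d` is the weak gradient of `v ∈ L²(Ω)`. -/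
def IsWeakGradient {d : ℕ} (Ω : Set (Space d)) (v : Space d → ℝ) (g : Space d → Space d) : Prop :=
  MemLp v 2 (volume.restrict Ω) ∧ MemLp g 2 (volume.restrict Ω) ∧
    ∀ φ : Space d → ℝ, IsTestFunction Ω φ →
      ∫ x in Ω, v x • gradient φ x = -∫ x in Ω, φ x • g x

/-- `v ∈ H¹₀(Ω)` with weak gradient `∇v = g` (which is unique almost everywhere): `H¹₀(Ω)` is the
closure of `C_c^∞(Ω)` in the norm of `H¹(Ω)`. -/
def MemH10 {d : ℕ} (Ω : Set (Space d)) (v : Space d → ℝ) (g : Space d → Space d) : Prop :=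
  IsWeakGradient Ω v g ∧
    ∃ φ : ℕ → Space d → ℝ, (∀ n, IsTestFunction Ω (φ n)) ∧
      Tendsto (fun n => eLpNorm (fun x => φ n x - v x) 2 (volume.restrict Ω)) atTop (𝓝 0) ∧
      Tendsto (fun n => eLpNorm (fun x => gradient (φ n) x - g x) 2 (volume.restrict Ω))
        atTop (𝓝 0)

/-- `τ ∈ H(div, Ω)` with weak divergence `div τ = δ` (which is unique almost everywhere). -/
def IsWeakDivergence {d : ℕ} (Ω : Set (Space d)) (τ : Space d → Space d) (δ : Space d → ℝ) :
    Prop :=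
  MemLp τ 2 (volume.restrict Ω) ∧ MemLp δ 2 (volume.restrict Ω) ∧
    ∀ φ : Space d → ℝ, IsTestFunction Ω φ →
      ∫ x in Ω, inner ℝ (τ x) (gradient φ x) = -∫ x in Ω, δ x * φ x

/-! ### Energy and ground state energy -/

/-- The energy `½ ‖g‖² + ½ (V v, v) + (κ/4) (|v|² v, v)` (inner products in `L²(Ω)`), written as
the integral of its density and with values in `[0, ∞]`. It is used for `V, κ ≥ 0`, where all the
terms of the density are non-negative. With `g = ∇v` it is the Gross-Pitaevskii energy
of `v ∈ H¹₀(Ω)`; with `g = G_h v` it is the discrete energy of the piecewise constant `v`. -/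
def energy {d : ℕ} (Ω : Set (Space d)) (V : Space d → ℝ) (κ : ℝ)
    (v : Space d → ℝ) (g : Space d → Space d) : ℝ≥0∞ :=
  ∫⁻ x in Ω, ENNReal.ofReal
    (1 / 2 * ‖g x‖ ^ 2 + 1 / 2 * (V x * v x ^ 2) + κ / 4 * v x ^ 4)

/-- The ground state energy: the least energy among all `L²`-normalised `v ∈ H¹₀(Ω)`. -/
def groundStateEnergy {d : ℕ} (Ω : Set (Space d)) (V : Space d → ℝ) (κ : ℝ) : ℝ :=
  (⨅ (v : Space d → ℝ) (g : Space d → Space d) (_ : MemH10 Ω v g)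
    (_ : eLpNorm v 2 (volume.restrict Ω) = 1), energy Ω V κ v g).toReal

/-! ### Meshes and finite element spaces -/

/-- A geometrically conforming simplicial mesh of `Ω ⊆ ℝ^d`: finitely many non-degenerate
`d`-simplices, given by their sets of `d + 1` vertices, which cover the closure of `Ω`, and any two
of which intersect in the (possibly empty) common face spanned by their common vertices. -/
structure SimplicialMesh {d : ℕ} (Ω : Set (Space d)) where
  /-- The vertex sets of the elements. -/
  elements : Finset (Finset (Space d))
  card_eq : ∀ s ∈ elements, s.card = d + 1
  indep : ∀ s ∈ elements, AffineIndependent ℝ ((↑) : s → Space d)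
  inter_subset : ∀ s ∈ elements, ∀ t ∈ elements,
    convexHull ℝ (s : Set (Space d)) ∩ convexHull ℝ (t : Set (Space d)) ⊆
      convexHull ℝ ((s : Set (Space d)) ∩ (t : Set (Space d)))
  cover : ⋃ s ∈ elements, convexHull ℝ (s : Set (Space d)) = closure Ω

namespace SimplicialMesh

variable {d : ℕ} {Ω : Set (Space d)}

/-- The mesh size `h`: the maximal diameter of an element. -/
def meshSize (T : SimplicialMesh Ω) : ℝ :=
  ⨆ s : T.elements, Metric.diam (convexHull ℝ (s.1 : Set (Space d)))

/-- `v` is (almost everywhere on `Ω`) constant on each element of the mesh. The space `U_h`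
consists of these functions. -/
def IsPiecewiseConstant (T : SimplicialMesh Ω) (v : Space d → ℝ) : Prop :=
  ∀ s ∈ T.elements, ∃ c : ℝ,
    ∀ᵐ x ∂(volume.restrict Ω), x ∈ convexHull ℝ (s : Set (Space d)) → v x = c

/-- `τ` belongs to the lowest-order Raviart-Thomas space `Σ_h` and has divergence `δ`: it lies in
`H(div, Ω)`, and on each element it has the form `x ↦ a + b x` with `a ∈ ℝ^d`, `b ∈ ℝ`. -/
def IsRaviartThomas (T : SimplicialMesh Ω) (τ : Space d → Space d) (δ : Space d → ℝ) : Prop :=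
  IsWeakDivergence Ω τ δ ∧
    ∀ s ∈ T.elements, ∃ (a : Space d) (b : ℝ),
      ∀ᵐ x ∂(volume.restrict Ω), x ∈ convexHull ℝ (s : Set (Space d)) → τ x = a + b • x

/-- `σ = G_h v` for the discrete gradient `G_h : U_h → Σ_h`, that is, `σ ∈ Σ_h` and
`(σ, τ) + (div τ, v) = 0` for all `τ ∈ Σ_h`. -/
def IsDiscreteGradient (T : SimplicialMesh Ω) (v : Space d → ℝ) (σ : Space d → Space d) : Prop :=
  (∃ δ, T.IsRaviartThomas σ δ) ∧
    ∀ (τ : Space d → Space d) (δ : Space d → ℝ), T.IsRaviartThomas τ δ →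
      (∫ x in Ω, inner ℝ (σ x) (τ x)) + ∫ x in Ω, δ x * v x = 0

/-- The discrete ground state energy `E_h`: the least discrete energy among all `L²`-normalised
`v ∈ U_h`. -/
def discreteGroundStateEnergy (T : SimplicialMesh Ω) (V : Space d → ℝ) (κ : ℝ) : ℝ :=
  (⨅ (v : Space d → ℝ) (σ : Space d → Space d) (_ : T.IsPiecewiseConstant v)
    (_ : T.IsDiscreteGradient v σ) (_ : eLpNorm v 2 (volume.restrict Ω) = 1),
      energy Ω V κ v σ).toReal

end SimplicialMesh

end

end GrossPitaevskii

/-! Let `v` be admissible with energy `e`, and let `Πv` be its piecewise mean on the mesh.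
Raviart-Thomas divergences are piecewise constant, so integration by parts identifies `G_h Πv` with
the `L²` projection of `∇v` onto `Σ_h`; thus `‖G_h Πv‖ ≤ ‖∇v‖`
(`exists_isDiscreteGradient_meanFun`). Jensen's inequality on each element controls the other two
terms of the energy. Put `t = ‖Πv‖² ≤ 1`. Normalising `Πv` multiplies quadratic terms by `t⁻¹` and
the quartic term by `t⁻²`, whence `E_h t² ≤ e`.

By orthogonality and a Poincaré inequality with constant `h/π` on each element, `1 - t = ‖v - Πv‖² ≤
h²π⁻²‖∇v‖² ≤ 2h²π⁻²e`. So `t² ≥ 1 - 4h²π⁻²e` whenever `2h²π⁻²e ≤ 1`, and in every case `E_h (1 -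
4h²π⁻²e) ≤ e` (`discreteGroundStateEnergy_mul_le`). This is `E_h ≤ e (1 + 4h²π⁻²E_h)`; it remains to
take the infimum over `v`.

The Poincaré constant on a simplex comes from Fourier series. `alcoveFold` uses the gaps between `d
+ 1` points on a circle as barycentric coordinates: it folds space onto the simplex as the affine
Weyl group of type `A_d` folds onto its alcove, except that integer translations also rotate the
vertices. Hence `f ∘ alcoveFold` is periodic, and each cell of a cube covers the simplex affinely. A
nonzero frequency of this function pairs with the roots `e_i - e_j` to integers `s_i - s_j`, not all
zero, and `∑ (s_i - s_j)² ≥ 2d` gives the spectral gap `8π²d` (`poincare_simplex_cyclic`). The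
gradient term depends on the cyclic order of the vertices. Averaged over these orders it is at most
`(d + 1)³/d · h²‖∇f‖²`, and `(d + 1)³ ≤ 8d²` for `d ≤ 3` (`poincare_simplex`). -/

section TorusFourier

-- Fourier series and a Poincaré inequality on the torus.

noncomputable local instance unitAddCircleMeasureSpace : MeasureSpace UnitAddCircle := ⟨AddCircle.haarAddCircle⟩

local instance unitAddCircleIsAddHaar : Measure.IsAddHaarMeasure (volume : Measure UnitAddCircle) :=
  inferInstanceAs (Measure.IsAddHaarMeasure AddCircle.haarAddCircle)

local instance unitAddCircleIsProbability : IsProbabilityMeasure (volume : Measure UnitAddCircle) :=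
  inferInstanceAs (IsProbabilityMeasure AddCircle.haarAddCircle)

namespace UnitAddTorus

variable {ι : Type*} [Fintype ι]

lemma mFourier_apply_add (m : ι → ℤ) (x y : UnitAddTorus ι) :
    mFourier m (x + y) = mFourier m x * mFourier m y := by
  simp only [mFourier, ContinuousMap.coe_mk, ← Finset.prod_mul_distrib]
  refine Finset.prod_congr rfl fun i _ => ?_
  simp only [fourier_apply, Pi.add_apply, smul_add, AddCircle.toCircle_add, Circle.coe_mul]

lemma mFourier_coe (m : ι → ℤ) (a : ι → ℝ) :
    mFourier m (fun i => (a i : UnitAddCircle)) =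
      Complex.exp (Complex.I * ((2 * Real.pi * ∑ i, m i * a i : ℝ) : ℂ)) := by
  simp only [mFourier, ContinuousMap.coe_mk, fourier_coe_apply]
  rw [← Complex.exp_sum]
  congr 1
  push_cast
  rw [Finset.mul_sum, Finset.mul_sum]
  exact Finset.sum_congr rfl fun i _ => by ring

lemma mFourierCoeff_translate (P : C(UnitAddTorus ι, ℂ)) (a : UnitAddTorus ι) (m : ι → ℤ) :
    mFourierCoeff (fun x => P (x + a)) m = mFourier m a * mFourierCoeff P m := by
  unfold mFourierCoeff
  have h := integral_add_right_eq_self (μ := (volume : Measure (UnitAddTorus ι)))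
    (fun x => mFourier (-m) (x - a) • P x) a
  simp only [add_sub_cancel_right] at h
  rw [h, ← integral_const_mul]
  refine integral_congr_ae (Eventually.of_forall fun x => ?_)
  have h1 : mFourier (-m) x = mFourier (-m) (x - a) * mFourier (-m) a := by
    rw [← mFourier_apply_add, sub_add_cancel]
  have h2 : mFourier m a * mFourier (-m) a = 1 := by
    rw [← mFourier_add, add_neg_cancel, mFourier_zero]; rfl
  simp only [smul_eq_mul, h1]
  linear_combination (- mFourier (-m) (x - a) * P x) * h2

lemma hasSum_sq_mFourierCoeff_continuous (P : C(UnitAddTorus ι, ℂ)) :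
    HasSum (fun m => ‖mFourierCoeff P m‖ ^ 2) (∫ x, ‖P x‖ ^ 2) := by
  have h := hasSum_sq_mFourierCoeff (ContinuousMap.toLp 2 volume ℂ P)
  simp only [mFourierCoeff_toLp] at h
  convert h using 1
  refine integral_congr_ae ?_
  filter_upwards [ContinuousMap.coeFn_toLp (p := 2) (𝕜 := ℂ) volume P] with x hx
  rw [hx]

lemma norm_exp_I_sub_one_sq (θ : ℝ) :
    ‖Complex.exp (Complex.I * θ) - 1‖ ^ 2 = 2 - 2 * Real.cos θ := by
  rw [mul_comm, ← Complex.normSq_eq_norm_sq, Complex.exp_mul_I, Complex.normSq_apply]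
  simp only [← Complex.ofReal_cos, ← Complex.ofReal_sin, Complex.sub_re, Complex.add_re,
    Complex.mul_re, Complex.ofReal_re, Complex.ofReal_im, Complex.I_re, Complex.I_im,
    Complex.one_re, Complex.sub_im, Complex.add_im, Complex.mul_im, Complex.one_im]
  nlinarith [Real.sin_sq_add_cos_sq θ]

/-- Parseval for `P(· + a) - P`, whose coefficients are those of `P` times `e^{iθ} - 1`. Differences
replace derivatives because the folded functions are only Lipschitz. -/
lemma integral_norm_translate_sub_sq (P : C(UnitAddTorus ι, ℂ)) (a : ι → ℝ) :
    HasSum (fun m => ‖mFourierCoeff P m‖ ^ 2 *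
        (2 - 2 * Real.cos (2 * Real.pi * ∑ i, m i * a i)))
      (∫ x : UnitAddTorus ι, ‖P (x + fun i => (a i : UnitAddCircle)) - P x‖ ^ 2) := by
  set b : UnitAddTorus ι := fun i => (a i : UnitAddCircle)
  let Q : C(UnitAddTorus ι, ℂ) := ⟨fun x => P (x + b) - P x, by fun_prop⟩
  have hQ := hasSum_sq_mFourierCoeff_continuous Q
  refine HasSum.congr_fun hQ fun m => ?_
  have h1 : mFourierCoeff Q m = (mFourier m b - 1) * mFourierCoeff P m := by
    rw [sub_mul, one_mul, ← mFourierCoeff_translate]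
    unfold mFourierCoeff
    rw [← integral_sub]
    · exact integral_congr_ae (Eventually.of_forall fun x => by simp [Q, mul_sub])
    · exact Continuous.integrable_of_hasCompactSupport (by fun_prop) (.of_compactSpace _)
    · exact Continuous.integrable_of_hasCompactSupport (by fun_prop) (.of_compactSpace _)
  rw [h1, norm_mul, mul_pow, mFourier_coe, norm_exp_I_sub_one_sq]
  ring

lemma tendsto_two_sub_two_cos_div_sq (θ : ℝ) :
    Tendsto (fun t : ℝ => (2 - 2 * Real.cos (t * θ)) / t ^ 2) (𝓝[≠] 0) (𝓝 (θ ^ 2)) := by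
  have h1 : HasDerivAt (fun t : ℝ => Real.sin (t * (θ / 2))) (θ / 2) 0 := by
    have := ((hasDerivAt_id (0 : ℝ)).mul_const (θ / 2)).sin
    simpa using this
  have h2 := (hasDerivAt_iff_tendsto_slope_zero.1 h1).pow 2
  have h3 := h2.const_mul 4
  rw [show 4 * (θ / 2) ^ 2 = θ ^ 2 by ring] at h3
  refine h3.congr fun t => ?_
  have : Real.cos (t * θ) = 1 - 2 * Real.sin (t * (θ / 2)) ^ 2 := by
    rw [show t * θ = 2 * (t * (θ / 2)) by ring, Real.cos_two_mul]
    nlinarith [Real.sin_sq_add_cos_sq (t * (θ / 2))]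
  rw [this]
  simp
  ring

/-- A Poincaré inequality on the torus: the variance is controlled by the limit of difference
quotients in the directions `α j`. -/
theorem poincare_of_tendsto {J : Type*} [Fintype J] (P : C(UnitAddTorus ι, ℂ)) (α : J → ι → ℝ)
    (lam R : ℝ)
    (hlam : ∀ m : ι → ℤ, m ≠ 0 → mFourierCoeff P m ≠ 0 →
      lam ≤ ∑ j, (2 * Real.pi * ∑ i, m i * α j i) ^ 2)
    (hR : Tendsto (fun t : ℝ => (∑ j, ∫ x : UnitAddTorus ι,
        ‖P (x + fun i => ((t * α j i : ℝ) : UnitAddCircle)) - P x‖ ^ 2) / t ^ 2)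
      (𝓝[≠] 0) (𝓝 R)) :
    lam * ((∫ x, ‖P x‖ ^ 2) - ‖∫ x, P x‖ ^ 2) ≤ R := by
  classical
  have hS := hasSum_sq_mFourierCoeff_continuous P
  have h0 : mFourierCoeff P 0 = ∫ x, P x := by simp [mFourierCoeff, mFourier_zero]
  -- Only finite partial sums are passed to the limit `t → 0`; their terms are nonnegative, so no
  -- interchange of limit and series is needed.
  have hfin : ∀ S : Finset (ι → ℤ), ∑ m ∈ S, ‖mFourierCoeff P m‖ ^ 2 *
      ∑ j, (2 * Real.pi * ∑ i, m i * α j i) ^ 2 ≤ R := by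
    intro S
    have hl : Tendsto (fun t : ℝ => ∑ m ∈ S, ‖mFourierCoeff P m‖ ^ 2 *
        ∑ j, (2 - 2 * Real.cos (t * (2 * Real.pi * ∑ i, m i * α j i))) / t ^ 2) (𝓝[≠] 0)
        (𝓝 (∑ m ∈ S, ‖mFourierCoeff P m‖ ^ 2 *
          ∑ j, (2 * Real.pi * ∑ i, m i * α j i) ^ 2)) :=
      tendsto_finsetSum _ fun m _ => (tendsto_finsetSum _ fun j _ =>
        tendsto_two_sub_two_cos_div_sq _).const_mul _
    refine le_of_tendsto_of_tendsto hl hR (Eventually.of_forall fun t => ?_)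
    have h1 := fun j => integral_norm_translate_sub_sq P (fun i => t * α j i)
    have h2 := hasSum_sum (s := Finset.univ) fun j _ => h1 j
    have h3 := sum_le_hasSum S (fun m _ => Finset.sum_nonneg fun j _ =>
      mul_nonneg (sq_nonneg _) (sub_nonneg.2 (by
        linarith [Real.cos_le_one (2 * Real.pi * ∑ i, (m i : ℝ) * (t * α j i))]))) h2
    have h4 := div_le_div_of_nonneg_right h3 (sq_nonneg t)
    refine le_trans (le_of_eq ?_) h4
    rw [Finset.sum_div]
    refine Finset.sum_congr rfl fun m _ => ?_
    rw [← Finset.mul_sum, mul_div_assoc, Finset.sum_div]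
    congr 1
    refine Finset.sum_congr rfl fun j _ => ?_
    congr 4
    rw [Finset.mul_sum, Finset.mul_sum, Finset.mul_sum]
    exact Finset.sum_congr rfl fun i _ => by ring
  -- The variance is the Parseval sum without the zero mode.
  have hS' : HasSum (fun m => lam * (if m = 0 then 0 else ‖mFourierCoeff P m‖ ^ 2))
      (lam * ((∫ x, ‖P x‖ ^ 2) - ‖∫ x, P x‖ ^ 2)) := by
    refine HasSum.mul_left _ ?_
    have := hS.sub (hasSum_ite_eq (0 : ι → ℤ) (‖∫ x, P x‖ ^ 2))
    refine this.congr_fun fun m => ?_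
    split_ifs with h
    · rw [h, h0, sub_self]
    · rw [sub_zero]
  refine hasSum_le_of_sum_le hS' fun S => le_trans (Finset.sum_le_sum fun m _ => ?_) (hfin S)
  split_ifs with h
  · rw [mul_zero]; positivity
  · rw [mul_comm]
    by_cases hc : mFourierCoeff P m = 0
    · simp [hc]
    · exact mul_le_mul_of_nonneg_left (hlam m h hc) (sq_nonneg _)

/-- The frequencies of a function with an additional period. -/
lemma exists_int_of_periodic (P : C(UnitAddTorus ι, ℂ)) (a : ι → ℝ)
    (hP : ∀ x : UnitAddTorus ι, P (x + fun i => (a i : UnitAddCircle)) = P x) (m : ι → ℤ)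
    (hm : mFourierCoeff P m ≠ 0) : ∃ N : ℤ, ∑ i, m i * a i = N := by
  have h := mFourierCoeff_translate P (fun i => (a i : UnitAddCircle)) m
  simp only [hP] at h
  -- A period multiplies the `m`-th coefficient by a character value, which must be `1` when the
  -- coefficient is nonzero.
  have h1 : mFourier m (fun i => (a i : UnitAddCircle)) = 1 :=
    mul_right_cancel₀ hm (by rw [← h, one_mul])
  rw [mFourier_coe, Complex.exp_eq_one_iff] at h1
  obtain ⟨N, hN⟩ := h1
  refine ⟨N, ?_⟩
  have h2 : Complex.I * (2 * Real.pi) * (((∑ i, m i * a i : ℝ) : ℂ) - (N : ℂ)) = 0 := by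
    push_cast at hN ⊢
    linear_combination hN
  have h3 : (Complex.I * (2 * Real.pi) : ℂ) ≠ 0 := by simp [Real.pi_ne_zero]
  have h4 := (mul_eq_zero.1 h2).resolve_left h3
  exact_mod_cast sub_eq_zero.1 h4

/-- The Poincaré inequality for periodic functions on `ℝ^ι`. -/
theorem poincare_of_periodic {J : Type*} [Fintype J] {n : ℕ} (hn : 0 < n)
    {U : (ι → ℝ) → ℝ} (hU : Continuous U)
    (hper : ∀ (k : ι → ℤ), (n : ℤ) ∣ ∑ i, k i → ∀ y, U (y + fun i => (k i : ℝ)) = U y)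
    (α : J → ι → ℝ) (lam R : ℝ)
    (hlam : ∀ m : ι → ℤ, m ≠ 0 →
      (∀ k : ι → ℤ, (n : ℤ) ∣ ∑ i, k i → ∃ N : ℤ, ∑ i, m i * (k i / n : ℝ) = N) →
      lam ≤ ∑ j, (2 * Real.pi * ∑ i, m i * (α j i / n)) ^ 2)
    (hR : Tendsto (fun t : ℝ => (∑ j, ∫ w : ι → ℝ in {w | ∀ i, w i ∈ Set.Ioc (0 : ℝ) 1},
        (U ((n : ℝ) • w + t • α j) - U ((n : ℝ) • w)) ^ 2) / t ^ 2)
      (𝓝[≠] 0) (𝓝 R)) :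
    lam * ((∫ w : ι → ℝ in {w | ∀ i, w i ∈ Set.Ioc (0 : ℝ) 1}, U ((n : ℝ) • w) ^ 2) -
      (∫ w : ι → ℝ in {w | ∀ i, w i ∈ Set.Ioc (0 : ℝ) 1}, U ((n : ℝ) • w)) ^ 2) ≤ R := by
  have hn' : (n : ℝ) ≠ 0 := by exact_mod_cast hn.ne'
  have hq0 : IsOpenQuotientMap (Pi.map fun (_ : ι) (x : ℝ) => (x : UnitAddCircle)) :=
    IsOpenQuotientMap.piMap fun _ => QuotientAddGroup.isOpenQuotientMap_mk
  let q : C(ι → ℝ, UnitAddTorus ι) := ⟨_, hq0.continuous⟩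
  have hq : IsQuotientMap q := hq0.isQuotientMap
  let g : C(ι → ℝ, ℂ) := ⟨fun w => ((U ((n : ℝ) • w) : ℝ) : ℂ), by fun_prop⟩
  -- Descending to the torus uses only the periods in `n ℤ^ι`; the remaining ones restrict the
  -- frequencies below.
  have hg : Function.FactorsThrough g q := by
    intro w w' h
    have h1 : ∀ i, ∃ l : ℤ, w i - w' i = l := by
      intro i
      have h2 : ((w i : ℝ) : UnitAddCircle) = (w' i : ℝ) := congrFun h i
      obtain ⟨l, hl⟩ := (AddCircle.coe_eq_zero_iff (1 : ℝ)).1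
        (by rw [AddCircle.coe_sub, h2, sub_self] : ((w i - w' i : ℝ) : UnitAddCircle) = 0)
      exact ⟨l, by simpa using hl.symm⟩
    choose l hl using h1
    have h3 := hper (fun i => n * l i) (by rw [← Finset.mul_sum]; exact dvd_mul_right _ _)
      ((n : ℝ) • w')
    have h4 : ((n : ℝ) • w' + fun i => (((n : ℤ) * l i : ℤ) : ℝ)) = (n : ℝ) • w := by
      funext i
      simp only [Pi.add_apply, Pi.smul_apply, smul_eq_mul]
      push_cast
      rw [← hl i]
      ring
    rw [h4] at h3
    simp only [g, ContinuousMap.coe_mk, h3]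
  let P : C(UnitAddTorus ι, ℂ) := hq.lift g hg
  have hP : ∀ w : ι → ℝ, P (fun i => (w i : UnitAddCircle)) = ((U ((n : ℝ) • w) : ℝ) : ℂ) :=
    fun w => DFunLike.congr_fun (hq.lift_comp g hg) w
  have hadd : ∀ (w a : ι → ℝ), ((fun i => (w i : UnitAddCircle)) + fun i => (a i : UnitAddCircle))
      = (fun i => ((w + a) i : UnitAddCircle)) := fun w a => rfl
  have hset : {w : ι → ℝ | ∀ i, w i ∈ Set.Ioc ((0 : ι → ℝ) i) ((0 : ι → ℝ) i + 1)} =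
      {w | ∀ i, w i ∈ Set.Ioc (0 : ℝ) 1} := by simp
  have hint : ∀ {E : Type} [NormedAddCommGroup E] [NormedSpace ℝ E] (f : UnitAddTorus ι → E),
      ∫ x, f x = ∫ w : ι → ℝ in {w | ∀ i, w i ∈ Set.Ioc (0 : ℝ) 1},
        f (fun i => (w i : UnitAddCircle)) := by
    intro E _ _ f
    rw [← hset]
    exact integral_preimage f 0
  have key := poincare_of_tendsto P (fun j i => α j i / n) lam R ?_ ?_
  · rw [hint, hint] at key
    simp only [hP, Complex.norm_real, Real.norm_eq_abs, sq_abs] at key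
    rw [show (∫ a : ι → ℝ in {w | ∀ i, w i ∈ Set.Ioc (0 : ℝ) 1}, ((U ((n : ℝ) • a) : ℝ) : ℂ)) =
      ((∫ a : ι → ℝ in {w | ∀ i, w i ∈ Set.Ioc (0 : ℝ) 1}, U ((n : ℝ) • a) : ℝ) : ℂ) from
        integral_ofReal, Complex.norm_real, Real.norm_eq_abs, sq_abs] at key
    exact key
  -- In the rescaled variable the periods of `U` become `k / n`.
  · intro m hm0 hm
    refine hlam m hm0 fun k hk => ?_
    refine exists_int_of_periodic P (fun i => k i / n) (fun x => ?_) m hm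
    obtain ⟨w, rfl⟩ := hq0.surjective x
    have : (Pi.map (fun (_ : ι) (x : ℝ) => (x : UnitAddCircle)) w) =
      fun i => (w i : UnitAddCircle) := rfl
    rw [this, hadd w (fun i => k i / n), hP, hP, smul_add]
    congr 1
    rw [← hper k hk ((n : ℝ) • w)]
    congr 2
    funext i
    simp only [Pi.smul_apply, smul_eq_mul]
    field_simp
  · refine hR.congr fun t => ?_
    congr 1
    refine Finset.sum_congr rfl fun j _ => ?_
    rw [hint]
    refine integral_congr_ae (Eventually.of_forall fun w => ?_)
    have h5 : (n : ℝ) • (w + fun i => t * (α j i / n)) = (n : ℝ) • w + t • α j := by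
      funext i
      simp only [Pi.smul_apply, smul_eq_mul, Pi.add_apply]
      field_simp
    simp only [hadd w (fun i => t * (α j i / n)), hP, h5]
    rw [← Complex.ofReal_sub, Complex.norm_real, Real.norm_eq_abs, sq_abs]

end UnitAddTorus

end TorusFourier

/-! ### Folding onto a simplex by cyclic order statistics. -/

section AlcoveFolding

/-- The `k`-th smallest element of the multiset `{x j + m | j ∈ Fin (d + 1), m ∈ ℤ}`, with the
normalisation that the count starts at `x 0` if `x 0 ≤ ⋯ ≤ x d ≤ x 0 + 1`. -/
noncomputable def cyclicOrderStat {d : ℕ} (x : Fin (d + 1) → ℝ) (k : ℤ) : ℝ :=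
  sInf {s : ℝ | k ≤ d + ∑ j, ⌊s - x j⌋}

namespace cyclicOrderStat

variable {d : ℕ}

lemma set_nonempty (x : Fin (d + 1) → ℝ) (k : ℤ) :
    {s : ℝ | k ≤ d + ∑ j, ⌊s - x j⌋}.Nonempty := by
  refine ⟨∑ j, |x j| + |k|, ?_⟩
  have h : ∀ j ∈ Finset.univ, |k| ≤ ⌊(∑ j, |x j| + |(k : ℝ)|) - x j⌋ := by
    intro j _
    rw [Int.le_floor]
    have h1 : |x j| ≤ ∑ j, |x j| :=
      Finset.single_le_sum (f := fun j => |x j|) (fun i _ => abs_nonneg _) (Finset.mem_univ j)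
    push_cast
    linarith [le_abs_self (x j)]
  have h2 := Finset.card_nsmul_le_sum _ _ _ h
  simp only [Finset.card_univ, Fintype.card_fin, nsmul_eq_mul, Set.mem_ofPred_eq] at h2 ⊢
  push_cast at h2 ⊢
  have : (0 : ℤ) ≤ d := by positivity
  nlinarith [le_abs_self k, abs_nonneg k]

lemma set_bddBelow (x : Fin (d + 1) → ℝ) (k : ℤ) :
    BddBelow {s : ℝ | k ≤ d + ∑ j, ⌊s - x j⌋} := by
  refine ⟨(k - d + ∑ j, x j) / (d + 1), fun s hs => ?_⟩
  have h1 : (k : ℝ) ≤ d + ∑ j, (⌊s - x j⌋ : ℝ) := by exact_mod_cast hs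
  have h2 : ∑ j, (⌊s - x j⌋ : ℝ) ≤ ∑ j, (s - x j) :=
    Finset.sum_le_sum fun j _ => Int.floor_le _
  rw [Finset.sum_sub_distrib] at h2
  simp only [Finset.sum_const, Finset.card_univ, Fintype.card_fin, nsmul_eq_mul] at h2
  push_cast at h2
  rw [div_le_iff₀ (by positivity)]
  linarith

lemma mono_left {x x' : Fin (d + 1) → ℝ} (h : x ≤ x') (k : ℤ) :
    cyclicOrderStat x k ≤ cyclicOrderStat x' k := by
  refine csInf_le_csInf (set_bddBelow x k) (set_nonempty x' k) fun s hs => ?_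
  simp only [Set.mem_ofPred_eq] at hs ⊢
  refine hs.trans ?_
  gcongr with j
  exact h j

lemma add_const_le (x : Fin (d + 1) → ℝ) (c : ℝ) (k : ℤ) :
    cyclicOrderStat (fun j => x j + c) k ≤ cyclicOrderStat x k + c := by
  rw [← sub_le_iff_le_add]
  refine le_csInf (set_nonempty x k) fun s hs => ?_
  rw [sub_le_iff_le_add]
  refine csInf_le (set_bddBelow _ k) ?_
  simpa using hs

lemma add_const (x : Fin (d + 1) → ℝ) (c : ℝ) (k : ℤ) :
    cyclicOrderStat (fun j => x j + c) k = cyclicOrderStat x k + c := by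
  refine le_antisymm (add_const_le x c k) ?_
  have := add_const_le (fun j => x j + c) (-c) k
  simp only [add_neg_cancel_right] at this
  linarith

/-- Monotonicity and equivariance under constants give Lipschitz constant `1` in the sup norm. -/
lemma le_add {x x' : Fin (d + 1) → ℝ} {r : ℝ} (h : ∀ i, |x i - x' i| ≤ r) (k : ℤ) :
    cyclicOrderStat x k ≤ cyclicOrderStat x' k + r := by
  rw [← add_const]
  exact mono_left (fun i => by linarith [(abs_le.1 (h i)).2]) k

lemma abs_sub_le {x x' : Fin (d + 1) → ℝ} {r : ℝ} (h : ∀ i, |x i - x' i| ≤ r) (k : ℤ) :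
    |cyclicOrderStat x k - cyclicOrderStat x' k| ≤ r := by
  have h1 := le_add h k
  have h2 := le_add (x := x') (x' := x) (r := r) (fun i => by rw [abs_sub_comm]; exact h i) k
  exact abs_le.2 ⟨by linarith, by linarith⟩

/-- Integer shifts leave the multiset `{x j + m}` unchanged and only move the origin of the count.
-/
lemma add_int (x : Fin (d + 1) → ℝ) (e : Fin (d + 1) → ℤ) (k : ℤ) :
    cyclicOrderStat (fun j => x j + e j) k = cyclicOrderStat x (k + ∑ j, e j) := by
  unfold cyclicOrderStat
  congr 1
  ext s
  have : ∀ j, ⌊s - (x j + e j)⌋ = ⌊s - x j⌋ - e j := fun j => by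
    rw [← sub_sub, Int.floor_sub_intCast]
  simp only [Set.mem_ofPred_eq, this, Finset.sum_sub_distrib]
  constructor <;> intro h <;> linarith

/-- The shift of every `x j` by `1` is evaluated twice: as a constant and as an integer vector of
sum `d + 1`. -/
lemma add_period (x : Fin (d + 1) → ℝ) (k : ℤ) :
    cyclicOrderStat x (k + (d + 1)) = cyclicOrderStat x k + 1 := by
  have h := add_int x (fun _ => 1) k
  simp only [Int.cast_one, add_const, Finset.sum_const, Finset.card_univ, Fintype.card_fin,
    nsmul_eq_mul, mul_one] at h
  rw [h]
  push_cast
  rfl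

lemma comp_perm (x : Fin (d + 1) → ℝ) (σ : Equiv.Perm (Fin (d + 1))) (k : ℤ) :
    cyclicOrderStat (x ∘ σ) k = cyclicOrderStat x k := by
  unfold cyclicOrderStat
  congr 1
  ext s
  have := Equiv.sum_comp σ fun j => ⌊s - x j⌋
  simp only [Set.mem_ofPred_eq, Function.comp, this]

/-- At `s = x j` the floors are at least `0` for indices `i ≤ j` and at least `-1` for the `d - j`
others, so the count reaches `j`. For `s < x j` the `d + 1 - j` indices `i ≥ j` contribute at most
`-1` each and the rest at most `0`, so it stays below `j`. -/
lemma eq_self {x : Fin (d + 1) → ℝ} (hx : Monotone x) (hx1 : x (Fin.last d) ≤ x 0 + 1)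
    (j : Fin (d + 1)) : cyclicOrderStat x j = x j := by
  have hle : ∀ i l, x i ≤ x l + 1 := fun i l =>
    (hx (Fin.le_last i)).trans (hx1.trans (add_le_add_left (hx (Fin.zero_le l)) 1))
  refine le_antisymm (csInf_le (set_bddBelow x j) ?_) (le_csInf (set_nonempty x j) ?_)
  · have h : ∀ i ∈ Finset.univ, (if j < i then (-1 : ℤ) else 0) ≤ ⌊x j - x i⌋ := by
      intro i _
      rw [Int.le_floor]
      split_ifs with hij
      · push_cast; linarith [hle i j]
      · push_cast; linarith [hx (not_lt.1 hij)]
    have h2 := Finset.sum_le_sum h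
    rw [← Finset.sum_filter, Finset.sum_const] at h2
    have h3 : (Finset.univ.filter fun i => j < i).card = d - j := by
      rw [Finset.filter_lt_eq_Ioi, Fin.card_Ioi]; omega
    rw [h3] at h2
    simp only [Set.mem_ofPred_eq]
    have := j.is_le
    have h4 : ((d - (j : ℕ) : ℕ) : ℤ) = d - j := by omega
    rw [nsmul_eq_mul, h4] at h2
    linarith
  · intro s hs
    by_contra! hlt
    have h : ∀ i ∈ Finset.univ, ⌊s - x i⌋ ≤ (if j ≤ i then (-1 : ℤ) else 0) := by
      intro i _
      split_ifs with hij
      · rw [← Int.lt_add_one_iff, neg_add_cancel, Int.floor_lt]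
        push_cast; linarith [hx hij]
      · rw [← Int.lt_add_one_iff, zero_add, Int.floor_lt]
        push_cast; linarith [hle j i]
    have h2 := Finset.sum_le_sum h
    rw [← Finset.sum_filter, Finset.sum_const] at h2
    have h3 : (Finset.univ.filter fun i => j ≤ i).card = d + 1 - j := by
      rw [Finset.filter_le_eq_Ici, Fin.card_Ici]
    rw [h3] at h2
    simp only [Set.mem_ofPred_eq] at hs
    have := j.is_le
    have h4 : ((d + 1 - (j : ℕ) : ℕ) : ℤ) = d + 1 - j := by omega
    rw [nsmul_eq_mul, h4] at h2
    linarith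

end cyclicOrderStat

variable {d : ℕ} {E : Type*} [NormedAddCommGroup E] [NormedSpace ℝ E]

/-- The point of the simplex with vertices `v` whose barycentric coordinates are the gaps between
the points `x j` on the circle `ℝ / ℤ`. -/
noncomputable def alcoveFold (v : Fin (d + 1) → E) (x : Fin (d + 1) → ℝ) : E :=
  ∑ i : Fin (d + 1), (cyclicOrderStat x ((i : ℕ) + 1 : ℤ) - cyclicOrderStat x ((i : ℕ) : ℤ)) • v i

namespace alcoveFold

open cyclicOrderStat

lemma comp_perm (v : Fin (d + 1) → E) (x : Fin (d + 1) → ℝ) (σ : Equiv.Perm (Fin (d + 1))) :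
    alcoveFold v (x ∘ σ) = alcoveFold v x := by
  simp only [alcoveFold, cyclicOrderStat.comp_perm]

lemma add_const (v : Fin (d + 1) → E) (x : Fin (d + 1) → ℝ) (c : ℝ) :
    alcoveFold v (fun j => x j + c) = alcoveFold v x := by
  simp only [alcoveFold, cyclicOrderStat.add_const, add_sub_add_right_eq_sub]

lemma coe_finRotate (i : Fin (d + 1)) :
    ((finRotate (d + 1) i : ℕ) : ℤ) = (i : ℕ) + 1 - if i = Fin.last d then (d + 1 : ℤ) else 0 := by
  split_ifs with h
  · subst h; simp
  · rw [coe_finRotate_of_ne_last h]; simp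

/-- Moving the origin of the count passes the gaps cyclically along the vertices, one rotation per
unit. At the last index the gap wraps round, and `add_period` brings it back. -/
lemma add_int (v : Fin (d + 1) → E) (x : Fin (d + 1) → ℝ) (e : Fin (d + 1) → ℤ) (r : ℕ)
    (he : ∑ j, e j = r) :
    alcoveFold v (fun j => x j + e j) =
      alcoveFold (v ∘ ⇑((finRotate (d + 1)).symm ^ r)) x := by
  unfold alcoveFold
  simp only [cyclicOrderStat.add_int, he]
  clear he e
  induction r generalizing v with
  | zero => simp
  | succ r ih =>
    rw [pow_succ', Equiv.Perm.coe_mul, ← Function.comp_assoc, ← ih]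
    refine Eq.trans ?_ (Equiv.sum_comp (finRotate (d + 1)) _)
    refine Finset.sum_congr rfl fun i _ => ?_
    simp only [Function.comp, Equiv.symm_apply_apply]
    congr 1
    rw [coe_finRotate]
    split_ifs with h
    · have h1 := add_period x ((i : ℕ) + 1 - (d + 1) + 1 + r)
      have h2 := add_period x ((i : ℕ) + 1 - (d + 1) + r)
      rw [eq_sub_of_add_eq h1.symm, eq_sub_of_add_eq h2.symm, sub_sub_sub_cancel_right]
      push_cast
      congr 2 <;> ring
    · push_cast
      congr 2 <;> ring

/-- Each barycentric coordinate is a difference of two order statistics, hence the factor `2`. This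
bound later dominates the difference quotients. -/
lemma norm_sub_le (v : Fin (d + 1) → E) {x x' : Fin (d + 1) → ℝ} {r : ℝ}
    (h : ∀ i, |x i - x' i| ≤ r) :
    ‖alcoveFold v x - alcoveFold v x'‖ ≤ 2 * r * ∑ i, ‖v i‖ := by
  unfold alcoveFold
  rw [← Finset.sum_sub_distrib, Finset.mul_sum]
  refine (norm_sum_le _ _).trans (Finset.sum_le_sum fun i _ => ?_)
  rw [← sub_smul, norm_smul]
  refine mul_le_mul_of_nonneg_right ?_ (norm_nonneg _)
  have h1 := abs_le.1 (cyclicOrderStat.abs_sub_le h ((i : ℕ) + 1 : ℤ))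
  have h2 := abs_le.1 (cyclicOrderStat.abs_sub_le h ((i : ℕ) : ℤ))
  rw [Real.norm_eq_abs]
  exact abs_le.2 ⟨by linarith, by linarith⟩

/-- On the fundamental alcove the folding is an affine map. -/
lemma eq_affine (v : Fin (d + 1) → E) {x : Fin (d + 1) → ℝ} (hx : Monotone x)
    (hx1 : x (Fin.last d) ≤ x 0 + 1) :
    alcoveFold v x = v (Fin.last d) + ∑ i, x i • (v ((finRotate (d + 1)).symm i) - v i) := by
  have h1 : ∀ i : Fin (d + 1), cyclicOrderStat x ((i : ℕ) + 1 : ℤ) =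
      x (finRotate (d + 1) i) + if i = Fin.last d then 1 else 0 := by
    intro i
    rw [← cyclicOrderStat.eq_self hx hx1 (finRotate (d + 1) i), coe_finRotate]
    split_ifs with h
    · rw [← add_period]; congr 1; ring
    · simp
  have h2 : ∑ i, x i • v ((finRotate (d + 1)).symm i) = ∑ i, x (finRotate (d + 1) i) • v i := by
    rw [← Equiv.sum_comp (finRotate _)]; simp
  unfold alcoveFold
  simp only [h1, smul_sub, Finset.sum_sub_distrib, h2, cyclicOrderStat.eq_self hx hx1, sub_smul,
    add_smul, Finset.sum_add_distrib, ite_smul, one_smul, zero_smul]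
  rw [Finset.sum_ite_eq' Finset.univ (Fin.last d) v]
  simp only [Finset.mem_univ, if_true]
  abel

end alcoveFold

end AlcoveFolding

/-! ### The Kuhn triangulation of the cube. -/

section KuhnDecomposition

lemma ae_linearMap_ne {E : Type*} [NormedAddCommGroup E] [NormedSpace ℝ E] [FiniteDimensional ℝ E]
    [MeasurableSpace E] [BorelSpace E] (μ : Measure E) [μ.IsAddHaarMeasure]
    (L : E →ₗ[ℝ] ℝ) (hL : L ≠ 0) (c : ℝ) : ∀ᵐ w ∂μ, L w ≠ c := by
  by_cases hc : ∃ p, L p = c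
  · obtain ⟨p, hp⟩ := hc
    have h := Measure.addHaar_affineSubspace μ (AffineSubspace.mk' p (LinearMap.ker L)) ?_
    · refine measure_mono_null (fun w hw => ?_) h
      have hw' : L w = c := by simpa using hw
      simp [AffineSubspace.mem_mk', hw', hp]
    · intro htop
      apply hL
      ext w
      have : p + w ∈ AffineSubspace.mk' p (LinearMap.ker L) := by rw [htop]; trivial
      simpa [AffineSubspace.mem_mk'] using this
  · exact Eventually.of_forall fun w hw => hc ⟨w, hw⟩

/-- The open Kuhn simplex `0 < y 0 < ⋯ < y (d - 1) < 1`. -/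
def kuhnSimplex (d : ℕ) : Set (Fin d → ℝ) := {y | StrictMono y ∧ ∀ i, 0 < y i ∧ y i < 1}

lemma isOpen_kuhnSimplex (d : ℕ) : IsOpen (kuhnSimplex d) := by
  have : kuhnSimplex d = (⋂ i, ⋂ j, ⋂ _ : i < j, {y | y i < y j}) ∩
      ⋂ i, ({y | 0 < y i} ∩ {y | y i < 1}) := by
    ext y
    simp [kuhnSimplex, StrictMono]
  rw [this]
  refine IsOpen.inter ?_ ?_
  · refine isOpen_iInter_of_finite fun i => isOpen_iInter_of_finite fun j =>
      isOpen_iInter_of_finite fun _ => isOpen_lt (by fun_prop) (by fun_prop)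
  · exact isOpen_iInter_of_finite fun i => (isOpen_lt (by fun_prop) (by fun_prop)).inter
      (isOpen_lt (by fun_prop) (by fun_prop))

variable {d n : ℕ}

/-- The cell with index `(k, σ)` of the Kuhn triangulation of the unit cube with `n ^ d` cubes. -/
def kuhnCell (k : Fin d → Fin n) (σ : Equiv.Perm (Fin d)) : Set (Fin d → ℝ) :=
  {w | (fun i => n * w (σ i) - (k (σ i) : ℕ)) ∈ kuhnSimplex d}

lemma isOpen_kuhnCell (k : Fin d → Fin n) (σ : Equiv.Perm (Fin d)) : IsOpen (kuhnCell k σ) :=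
  (isOpen_kuhnSimplex d).preimage (by fun_prop)

lemma mem_kuhnCell {k : Fin d → Fin n} {σ : Equiv.Perm (Fin d)} {w : Fin d → ℝ} :
    w ∈ kuhnCell k σ ↔ StrictMono (fun i => n * w (σ i) - (k (σ i) : ℕ)) ∧
      ∀ i, 0 < n * w i - (k i : ℕ) ∧ n * w i - (k i : ℕ) < 1 := by
  simp only [kuhnCell, kuhnSimplex, Set.mem_ofPred_eq]
  refine and_congr_right fun _ => ⟨fun h i => ?_, fun h i => h (σ i)⟩
  simpa using h (σ.symm i)

/-- A point of a cell determines `k` as the integer parts of `n w`, and `σ` as the only permutation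
sorting the distinct fractional parts. -/
lemma pairwise_disjoint_kuhnCell : Pairwise (Function.onFun Disjoint
    fun p : (Fin d → Fin n) × Equiv.Perm (Fin d) => kuhnCell p.1 p.2) := by
  rintro ⟨k, σ⟩ ⟨k', σ'⟩ hne
  refine Set.disjoint_left.2 fun w hw hw' => hne ?_
  rw [mem_kuhnCell] at hw hw'
  have hk : k = k' := by
    funext i
    have h1 := hw.2 i
    have h2 := hw'.2 i
    have h3 : ((k i : ℕ) : ℝ) < (k' i : ℕ) + 1 := by linarith
    have h4 : ((k' i : ℕ) : ℝ) < (k i : ℕ) + 1 := by linarith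
    norm_cast at h3 h4
    exact Fin.ext (by omega)
  subst hk
  have hr : Set.range (fun i => n * w (σ i) - (k (σ i) : ℕ)) =
      Set.range (fun i => n * w (σ' i) - (k (σ' i) : ℕ)) := by
    rw [show (fun i => (n : ℝ) * w (σ i) - (k (σ i) : ℕ)) =
      (fun i => (n : ℝ) * w i - (k i : ℕ)) ∘ σ from rfl,
      show (fun i => (n : ℝ) * w (σ' i) - (k (σ' i) : ℕ)) =
      (fun i => (n : ℝ) * w i - (k i : ℕ)) ∘ σ' from rfl, EquivLike.range_comp,
      EquivLike.range_comp]
  have hinj : Function.Injective fun i => (n : ℝ) * w i - (k i : ℕ) := by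
    have := hw.1.injective
    intro i j hij
    have h5 := @this (σ.symm i) (σ.symm j) (by simpa using hij)
    simpa using h5
  have heq := (StrictMono.range_inj hw.1 hw'.1).1 hr
  refine Prod.ext rfl (Equiv.ext fun i => hinj (congrFun heq i))

/-- Almost surely no `n w i` and no difference `n w i - n w j` with `i ≠ j` is an integer. For such
`w` in the cube, take integer parts for `k` and sort the fractional parts for `σ`. -/
lemma ae_mem_iUnion_kuhnCell (hn : 0 < n) :
    ({w : Fin d → ℝ | ∀ i, w i ∈ Set.Ioc (0 : ℝ) 1} : Set _) =ᵐ[volume]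
      ⋃ p : (Fin d → Fin n) × Equiv.Perm (Fin d), kuhnCell p.1 p.2 := by
  have hn' : (0 : ℝ) < n := by exact_mod_cast hn
  have h1 : ∀ i : Fin d, ∀ z : ℤ, ∀ᵐ w : Fin d → ℝ, (n : ℝ) * w i ≠ z := by
    intro i z
    let L : (Fin d → ℝ) →ₗ[ℝ] ℝ := (n : ℝ) • LinearMap.proj i
    refine ae_linearMap_ne volume L (fun h => ?_) (z : ℝ)
    have := LinearMap.congr_fun h (fun _ => 1)
    simp [L, hn'.ne'] at this
  have h2 : ∀ i j : Fin d, i ≠ j → ∀ z : ℤ, ∀ᵐ w : Fin d → ℝ, (n : ℝ) * w i - n * w j ≠ z := by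
    intro i j hij z
    let L : (Fin d → ℝ) →ₗ[ℝ] ℝ := (n : ℝ) • LinearMap.proj i - (n : ℝ) • LinearMap.proj j
    refine ae_linearMap_ne volume L (fun h => ?_) (z : ℝ)
    have := LinearMap.congr_fun h (Pi.single i 1)
    simp [L, hn'.ne', hij] at this
  have h1' := ae_all_iff.2 fun i => ae_all_iff.2 (h1 i)
  have h2' := ae_all_iff.2 fun i => ae_all_iff.2 fun j => ae_all_iff.2 fun hij =>
    ae_all_iff.2 (h2 i j hij)
  filter_upwards [h1', h2'] with w hw1 hw2
  refine propext ?_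
  change w ∈ {w : Fin d → ℝ | ∀ i, w i ∈ Set.Ioc (0 : ℝ) 1} ↔ w ∈ ⋃ p :
    (Fin d → Fin n) × Equiv.Perm (Fin d), kuhnCell p.1 p.2
  simp only [Set.mem_ofPred_eq, Set.mem_iUnion, mem_kuhnCell, Set.mem_Ioc]
  constructor
  · intro h
    have hlt : ∀ i, ⌊(n : ℝ) * w i⌋₊ < n := fun i => by
      rw [Nat.floor_lt (mul_nonneg hn'.le (h i).1.le)]
      refine lt_of_le_of_ne (by nlinarith [(h i).2]) ?_
      exact_mod_cast hw1 i n
    let k : Fin d → Fin n := fun i => ⟨⌊(n : ℝ) * w i⌋₊, hlt i⟩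
    let y : Fin d → ℝ := fun i => n * w i - (k i : ℕ)
    have hinj : Function.Injective y := by
      intro i j hij
      by_contra hne
      refine hw2 i j hne ((k i : ℕ) - (k j : ℕ) : ℤ) ?_
      simp only [y] at hij
      push_cast
      linarith
    refine ⟨(k, Tuple.sort y), ?_, fun i => ⟨?_, ?_⟩⟩
    · exact (Tuple.monotone_sort y).strictMono_of_injective
        (hinj.comp (Tuple.sort y).injective)
    · have h3 := Nat.floor_le (mul_nonneg hn'.le (h i).1.le)
      rcases h3.lt_or_eq with h4 | h4
      · exact sub_pos.2 h4
      · exact absurd h4.symm (by exact_mod_cast hw1 i ⌊(n : ℝ) * w i⌋₊)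
    · have := Nat.lt_floor_add_one ((n : ℝ) * w i)
      simp only [k]
      linarith
  · rintro ⟨p, -, hp⟩ i
    have h3 := hp i
    have h4 : (((p.1 i : ℕ) : ℝ)) + 1 ≤ n := by exact_mod_cast (p.1 i).2
    have h5 : (0 : ℝ) ≤ (p.1 i : ℕ) := by positivity
    constructor
    · by_contra! hneg
      nlinarith
    · by_contra! hneg
      nlinarith

lemma setIntegral_kuhnCell (hn : 0 < n) (k : Fin d → Fin n) (σ : Equiv.Perm (Fin d))
    (Φ : (Fin d → ℝ) → ℝ) :
    ∫ w in kuhnCell k σ, Φ ((n : ℝ) • w) = ((n : ℝ) ^ d)⁻¹ *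
      ∫ y in kuhnSimplex d, Φ (fun i => y (σ.symm i) + (k i : ℕ)) := by
  have hn' : (0 : ℝ) < n := by exact_mod_cast hn
  rw [← integral_indicator (isOpen_kuhnCell k σ).measurableSet,
    ← integral_indicator (isOpen_kuhnSimplex d).measurableSet]
  set G : (Fin d → ℝ) → ℝ := (kuhnSimplex d).indicator
    (fun y => Φ (fun i => y (σ.symm i) + (k i : ℕ)))
  have h1 : ∀ w, (kuhnCell k σ).indicator (fun w => Φ ((n : ℝ) • w)) w =
      G (fun i => ((n : ℝ) • w) (σ i) - (k (σ i) : ℕ)) := by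
    intro w
    simp only [G, Set.indicator, kuhnCell, Set.mem_ofPred_eq, Pi.smul_apply, smul_eq_mul,
      Equiv.apply_symm_apply, sub_add_cancel]
    rfl
  simp only [h1]
  rw [Measure.integral_comp_smul volume
    (fun u : Fin d → ℝ => G (fun i => u (σ i) - (k (σ i) : ℕ)))]
  rw [Module.finrank_fin_fun, smul_eq_mul, abs_of_pos (by positivity)]
  congr 1
  have h2 := integral_sub_right_eq_self (μ := (volume : Measure (Fin d → ℝ)))
    (fun u => G (fun i => u (σ i))) (fun i => ((k i : ℕ) : ℝ))
  have h3 := (volume_measurePreserving_piCongrLeft (fun _ : Fin d => ℝ) σ).symm.integral_comp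
    (MeasurableEquiv.measurableEmbedding _) G
  simp only [Pi.sub_apply] at h2
  rw [h2, ← h3]
  rfl

/-- Integration over the unit cube by means of the Kuhn triangulation. -/
theorem integral_unitCube_eq_sum (hn : 0 < n) {Φ : (Fin d → ℝ) → ℝ} (hΦ : Continuous Φ) :
    ∫ w : Fin d → ℝ in {w | ∀ i, w i ∈ Set.Ioc (0 : ℝ) 1}, Φ ((n : ℝ) • w) =
      ∑ p : (Fin d → Fin n) × Equiv.Perm (Fin d), ((n : ℝ) ^ d)⁻¹ *
        ∫ y in kuhnSimplex d, Φ (fun i => y (p.2.symm i) + (p.1 i : ℕ)) := by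
  have hint : IntegrableOn (fun w => Φ ((n : ℝ) • w)) (Set.Icc (0 : Fin d → ℝ) 1) :=
    (show Continuous fun w => Φ ((n : ℝ) • w) by fun_prop).continuousOn.integrableOn_compact
      isCompact_Icc
  have hbox : IntegrableOn (fun w => Φ ((n : ℝ) • w))
      {w : Fin d → ℝ | ∀ i, w i ∈ Set.Ioc (0 : ℝ) 1} :=
    hint.mono_set fun w hw => by
      rw [Set.mem_ofPred_eq] at hw
      exact ⟨fun i => (hw i).1.le, fun i => (hw i).2⟩
  have hU := hbox.congr_set_ae (ae_mem_iUnion_kuhnCell hn).symm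
  rw [setIntegral_congr_set (ae_mem_iUnion_kuhnCell hn),
    integral_iUnion_fintype (fun p => (isOpen_kuhnCell p.1 p.2).measurableSet)
      pairwise_disjoint_kuhnCell
      (fun p => hU.mono_set (Set.subset_iUnion_of_subset p subset_rfl))]
  exact Finset.sum_congr rfl fun p _ => setIntegral_kuhnCell hn p.1 p.2 Φ

end KuhnDecomposition

/-! ### Barycentric coordinates on the Kuhn simplex and change of variables. -/

section KuhnParametrization

variable {d : ℕ}

/-- The cyclic edge vectors of a simplex with vertices `v`. -/
def cyclicEdge {E : Type*} [AddCommGroup E] (v : Fin (d + 1) → E) (i : Fin (d + 1)) : E :=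
  v ((finRotate (d + 1)).symm i) - v i

/-- The affine parametrisation of a simplex by the Kuhn simplex. -/
def kuhnParam {E : Type*} [AddCommGroup E] [Module ℝ E] (v : Fin (d + 1) → E) (y : Fin d → ℝ) : E :=
  v (Fin.last d) + ∑ i, (Fin.cons 0 y : Fin (d + 1) → ℝ) i • cyclicEdge v i

/-- The gaps of `(0, y)` round the circle are the barycentric coordinates of `kuhnParam v y`, so
positivity of all of them describes the open simplex. The extra `1` at the last index closes the
circle. -/
lemma cyclicGap_pos_iff (y : Fin d → ℝ) :
    (∀ i, 0 < (Fin.cons 0 y : Fin (d + 1) → ℝ) (finRotate (d + 1) i) -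
        (Fin.cons 0 y : Fin (d + 1) → ℝ) i + if i = Fin.last d then (1 : ℝ) else 0) ↔
      y ∈ kuhnSimplex d := by
  set x : Fin (d + 1) → ℝ := Fin.cons 0 y
  have hx0 : x 0 = 0 := rfl
  have hxs : ∀ l : Fin d, x l.succ = y l := fun l => by simp [x]
  have h1 : (∀ i, 0 < x (finRotate (d + 1) i) - x i + if i = Fin.last d then (1 : ℝ) else 0) ↔
      (∀ l : Fin d, x l.castSucc < x l.succ) ∧ x (Fin.last d) < 1 := by
    rw [Fin.forall_fin_succ']
    refine and_congr (forall_congr' fun l => ?_) ?_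
    · rw [finRotate_apply, Fin.coeSucc_eq_succ, if_neg (Fin.castSucc_lt_last l).ne, add_zero,
        sub_pos]
    · rw [finRotate_last, hx0, if_pos rfl]
      constructor <;> intro h <;> linarith
  rw [h1, ← Fin.strictMono_iff_lt_succ]
  constructor
  · rintro ⟨hm, hl⟩
    refine ⟨fun i j hij => ?_, fun i => ⟨?_, ?_⟩⟩
    · rw [← hxs, ← hxs]; exact hm (Fin.succ_lt_succ_iff.2 hij)
    · rw [← hxs, ← hx0]; exact hm (Fin.succ_pos i)
    · rw [← hxs]; exact (hm.monotone (Fin.le_last _)).trans_lt hl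
  · rintro ⟨hm, hb⟩
    refine ⟨fun i j => ?_, ?_⟩
    · refine Fin.cases (fun hj => ?_) (fun l => ?_) i
      · obtain ⟨m, rfl⟩ := Fin.exists_succ_eq.2 hj.ne'
        rw [hx0, hxs]; exact (hb m).1
      · refine Fin.cases (fun hj => absurd hj (Fin.not_lt_zero _)) (fun m hlm => ?_) j
        rw [hxs, hxs]; exact hm (Fin.succ_lt_succ_iff.1 hlm)
    · by_cases h0 : Fin.last d = 0
      · rw [h0, hx0]; exact one_pos
      · obtain ⟨m, hm'⟩ := Fin.exists_succ_eq.2 h0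
        rw [← hm', hxs]; exact (hb m).2

/-- Cyclic summation by parts. -/
lemma kuhnParam_eq_sum {E : Type*} [AddCommGroup E] [Module ℝ E] (v : Fin (d + 1) → E)
    (y : Fin d → ℝ) :
    kuhnParam v y = ∑ i, ((Fin.cons 0 y : Fin (d + 1) → ℝ) (finRotate (d + 1) i) -
        (Fin.cons 0 y : Fin (d + 1) → ℝ) i + if i = Fin.last d then (1 : ℝ) else 0) • v i := by
  set x : Fin (d + 1) → ℝ := Fin.cons 0 y
  have h2 : ∑ i, x i • v ((finRotate (d + 1)).symm i) = ∑ i, x (finRotate (d + 1) i) • v i := by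
    rw [← Equiv.sum_comp (finRotate (d + 1))]; simp
  simp only [kuhnParam, cyclicEdge, add_smul, sub_smul, smul_sub, Finset.sum_add_distrib,
    Finset.sum_sub_distrib, ite_smul, one_smul, zero_smul, Finset.sum_ite_eq', Finset.mem_univ,
    if_true]
  change _ + (∑ i, x i • v ((finRotate (d + 1)).symm i) - _) = _
  rw [h2]
  abel

lemma sum_cyclicGap (x : Fin (d + 1) → ℝ) :
    ∑ i, (x (finRotate (d + 1) i) - x i + if i = Fin.last d then (1 : ℝ) else 0) = 1 := by
  rw [Finset.sum_add_distrib, Finset.sum_sub_distrib, Equiv.sum_comp (finRotate (d + 1)) x]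
  simp

open GrossPitaevskii in
lemma exists_affineBasis {v : Fin (d + 1) → Space d} (hv : AffineIndependent ℝ v) :
    ∃ b : AffineBasis (Fin (d + 1)) ℝ (Space d), ⇑b = v :=
  ⟨⟨v, hv, by rw [hv.affineSpan_eq_top_iff_card_eq_finrank_add_one]; simp⟩, rfl⟩

open GrossPitaevskii in
lemma kuhnParam_mem_interior_iff {v : Fin (d + 1) → Space d} (hv : AffineIndependent ℝ v)
    (y : Fin d → ℝ) :
    kuhnParam v y ∈ interior (convexHull ℝ (Set.range v)) ↔ y ∈ kuhnSimplex d := by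
  obtain ⟨b, rfl⟩ := exists_affineBasis hv
  rw [b.interior_convexHull, ← cyclicGap_pos_iff, kuhnParam_eq_sum, Set.mem_ofPred_eq]
  refine forall_congr' fun i => ?_
  rw [← Finset.affineCombination_eq_linear_combination _ _ _ (sum_cyclicGap _),
    b.coord_apply_combination_of_mem (Finset.mem_univ i) (sum_cyclicGap _)]

open GrossPitaevskii in
lemma kuhnParam_injective {v : Fin (d + 1) → Space d} (hv : AffineIndependent ℝ v) :
    Function.Injective (kuhnParam v) := by
  obtain ⟨b, rfl⟩ := exists_affineBasis hv
  intro y y' h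
  have h1 : ∀ i, ((Fin.cons 0 y : Fin (d + 1) → ℝ) (finRotate (d + 1) i) -
        (Fin.cons 0 y : Fin (d + 1) → ℝ) i + if i = Fin.last d then (1 : ℝ) else 0) =
      ((Fin.cons 0 y' : Fin (d + 1) → ℝ) (finRotate (d + 1) i) -
        (Fin.cons 0 y' : Fin (d + 1) → ℝ) i + if i = Fin.last d then (1 : ℝ) else 0) := by
    intro i
    rw [← b.coord_apply_combination_of_mem (Finset.mem_univ i)
        (sum_cyclicGap (Fin.cons 0 y : Fin (d + 1) → ℝ)),
      ← b.coord_apply_combination_of_mem (Finset.mem_univ i)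
        (sum_cyclicGap (Fin.cons 0 y' : Fin (d + 1) → ℝ)),
      Finset.affineCombination_eq_linear_combination _ _ _ (sum_cyclicGap _),
      Finset.affineCombination_eq_linear_combination _ _ _ (sum_cyclicGap _),
      ← kuhnParam_eq_sum, ← kuhnParam_eq_sum, h]
  have h2 : ∀ i : Fin (d + 1), (Fin.cons 0 y : Fin (d + 1) → ℝ) i =
      (Fin.cons 0 y' : Fin (d + 1) → ℝ) i := by
    intro i
    induction i using Fin.induction with
    | zero => rfl
    | succ l ih =>
      have h3 := h1 l.castSucc
      rw [finRotate_apply, Fin.coeSucc_eq_succ, ih] at h3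
      linarith
  funext l
  simpa using h2 l.succ

open GrossPitaevskii in
/-- Integrals over a simplex are computed on the Kuhn simplex. -/
theorem exists_setIntegral_kuhnParam {v : Fin (d + 1) → Space d} (hv : AffineIndependent ℝ v) :
    ∃ c : ℝ, ∀ Ψ : Space d → ℝ, ∫ y in kuhnSimplex d, Ψ (kuhnParam v y) =
      c * ∫ x in convexHull ℝ (Set.range v), Ψ x := by
  let L : (Fin d → ℝ) →ₗ[ℝ] Space d :=
    { toFun := fun y => ∑ i, (Fin.cons 0 y : Fin (d + 1) → ℝ) i • cyclicEdge v i
      map_add' := fun y y' => by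
        simp only [Fin.sum_univ_succ, Fin.cons_zero, Fin.cons_succ, zero_smul, zero_add,
          Pi.add_apply, add_smul, Finset.sum_add_distrib]
      map_smul' := fun c y => by
        simp only [Fin.sum_univ_succ, Fin.cons_zero, Fin.cons_succ, zero_smul, zero_add,
          Pi.smul_apply, smul_assoc, Finset.smul_sum, RingHom.id_apply] }
  have hL : ∀ y, kuhnParam v y = v (Fin.last d) + L y := fun y => rfl
  have hinj : Function.Injective L := fun y y' h =>
    kuhnParam_injective hv (by rw [hL, hL, h])
  let Le := (LinearEquiv.ofInjectiveOfFinrankEq L hinj (by simp)).toContinuousLinearEquiv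
  have hLe : ∀ y, Le y = L y := fun y => rfl
  have := Le.isAddHaarMeasure_map volume
  -- Uniqueness of Haar measure supplies the constant without a determinant; only the sum of such
  -- constants over all cells matters, and integrating `1` will fix it.
  have hμ := Measure.isAddLeftInvariant_eq_smul (Measure.map Le volume) (volume : Measure (Space d))
  set c := Measure.addHaarScalarFactor (Measure.map Le volume) (volume : Measure (Space d))
  refine ⟨c, fun Ψ => ?_⟩
  rw [← integral_indicator (isOpen_kuhnSimplex d).measurableSet]
  set K := convexHull ℝ (Set.range v)
  have hK : (interior K : Set (Space d)) =ᵐ[volume] K := by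
    have h0 := (convex_convexHull ℝ (Set.range v)).addHaar_frontier (μ := volume)
    have hcl : IsClosed K := (Set.finite_range v).isCompact_convexHull ℝ |>.isClosed
    exact (interior_ae_eq_of_null_frontier h0)
  rw [← setIntegral_congr_set hK, ← integral_indicator isOpen_interior.measurableSet]
  have h1 : ∀ y, (kuhnSimplex d).indicator (fun y => Ψ (kuhnParam v y)) y =
      (fun z => (interior K).indicator Ψ (v (Fin.last d) + z)) (Le y) := by
    intro y
    have h2 := kuhnParam_mem_interior_iff hv y
    change _ = (interior K).indicator Ψ (kuhnParam v y)
    by_cases hy : y ∈ kuhnSimplex d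
    · rw [Set.indicator_of_mem hy, Set.indicator_of_mem (h2.2 hy)]
    · rw [Set.indicator_of_notMem hy, Set.indicator_of_notMem (fun h => hy (h2.1 h))]
  simp only [h1]
  have h3 := Le.toHomeomorph.measurableEmbedding.integral_map (μ := volume)
    (fun z => (interior K).indicator Ψ (v (Fin.last d) + z))
  refine h3.symm.trans ?_
  change ∫ z, _ ∂(Measure.map Le volume) = _
  rw [hμ, integral_smul_nnreal_measure, integral_add_left_eq_self
    (fun z => (interior K).indicator Ψ z)]
  rfl

end KuhnParametrization

/-! ### The spectral gap and the Poincaré inequality for one cyclic order of the vertices. -/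

section SimplexFourier

/-- The sum of the squared differences of a non-constant family of reals with integer
differences. -/
lemma two_mul_le_sum_sq_sub {d : ℕ} (s : Fin (d + 1) → ℝ) (hs : ∀ i j, ∃ N : ℤ, s i - s j = N)
    (a b : Fin (d + 1)) (hab : s a ≠ s b) : (2 * d : ℝ) ≤ ∑ i, ∑ j, (s i - s j) ^ 2 := by
  classical
  -- Unequal values of `s` differ by at least `1`, so this indicator of a level set has smaller
  -- differences. If the level set has `N` elements, the double sum for `u` is `2N(d + 1 - N)`, at
  -- least `2d` because `1 ≤ N ≤ d`.
  let u : Fin (d + 1) → ℝ := fun i => if s i = s a then 1 else 0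
  have h1 : ∀ i j, (u i - u j) ^ 2 ≤ (s i - s j) ^ 2 := by
    intro i j
    by_cases hij : s i = s j
    · have : u i = u j := by simp only [u, hij]
      rw [hij, this]
      simp
    · obtain ⟨N, hN⟩ := hs i j
      have hN0 : N ≠ 0 := by
        rintro rfl
        exact hij (sub_eq_zero.1 (by rw [hN]; simp))
      have h2 : (1 : ℝ) ≤ (s i - s j) ^ 2 := by
        rw [hN]
        have : (1 : ℤ) ≤ N ^ 2 := by nlinarith [Int.one_le_abs hN0, sq_abs N]
        exact_mod_cast this
      have h3 : (u i - u j) ^ 2 ≤ 1 := by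
        simp only [u]
        split_ifs <;> norm_num
      linarith
  have h2 : ∑ i, ∑ j, (u i - u j) ^ 2 = 2 * (d + 1) * (∑ i, u i ^ 2) - 2 * (∑ i, u i) ^ 2 := by
    simp only [sub_sq, Finset.sum_add_distrib, Finset.sum_sub_distrib, Finset.sum_const,
      Finset.card_univ, Fintype.card_fin, nsmul_eq_mul, ← Finset.mul_sum, ← Finset.sum_mul]
    push_cast
    ring
  have h3 : ∑ i, u i ^ 2 = ∑ i, u i :=
    Finset.sum_congr rfl fun i _ => by simp only [u]; split_ifs <;> norm_num
  have h4 : 1 ≤ ∑ i, u i := by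
    have := Finset.single_le_sum (f := u) (fun i _ => by simp only [u]; split_ifs <;> norm_num)
      (Finset.mem_univ a)
    simpa [u] using this
  have h5 : ∑ i, u i ≤ d := by
    have h6 := Finset.single_le_sum (f := fun i => 1 - u i)
      (fun i _ => by simp only [u]; split_ifs <;> norm_num) (Finset.mem_univ b)
    have h7 : u b = 0 := by simp only [u]; rw [if_neg (Ne.symm hab)]
    simp only [h7, Finset.sum_sub_distrib, Finset.sum_const, Finset.card_univ, Fintype.card_fin,
      nsmul_eq_mul] at h6
    push_cast at h6
    linarith
  calc (2 * d : ℝ) ≤ ∑ i, ∑ j, (u i - u j) ^ 2 := by rw [h2, h3]; nlinarith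
    _ ≤ _ := Finset.sum_le_sum fun i _ => Finset.sum_le_sum fun j _ => h1 i j

variable {d : ℕ}

/-- The roots of type `A_d`, in the coordinates on `ℝ^(d + 1)`. -/
def rootVec (p : Fin (d + 1) × Fin (d + 1)) : Fin (d + 1) → ℝ :=
  Pi.single p.1 1 - Pi.single p.2 1

lemma abs_rootVec_le (p : Fin (d + 1) × Fin (d + 1)) (l : Fin (d + 1)) : |rootVec p l| ≤ 1 := by
  simp only [rootVec, Pi.sub_apply, Pi.single_apply]
  split_ifs <;> norm_num

/-- The roots of type `A_d` modulo the diagonal. -/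
def rootVec' (p : Fin (d + 1) × Fin (d + 1)) (l : Fin d) : ℝ := rootVec p l.succ - rootVec p 0

lemma sum_smul_rootVec {E : Type*} [AddCommGroup E] [Module ℝ E] (a : Fin (d + 1) → E)
    (p : Fin (d + 1) × Fin (d + 1)) : ∑ l, rootVec p l • a l = a p.1 - a p.2 := by
  simp only [rootVec, Pi.sub_apply, sub_smul, Finset.sum_sub_distrib, Pi.single_apply, ite_smul,
    one_smul, zero_smul, Finset.sum_ite_eq', Finset.mem_univ, if_true]

/-- With `s j` the pairing of `m / (d + 1)` with the `j`-th unit vector modulo the diagonal,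
periodicity along the roots makes all `s i - s j` integers, so `two_mul_le_sum_sq_sub` applies; its
`2d` is multiplied by `(2π)²`. -/
lemma le_sum_rootVec' (m : Fin d → ℤ) (hm : m ≠ 0)
    (h : ∀ k : Fin d → ℤ, ((d + 1 : ℕ) : ℤ) ∣ ∑ i, k i →
      ∃ N : ℤ, ∑ i, m i * (k i / (d + 1 : ℕ) : ℝ) = N) :
    8 * Real.pi ^ 2 * d ≤
      ∑ p, (2 * Real.pi * ∑ i, m i * (rootVec' (d := d) p i / (d + 1 : ℕ))) ^ 2 := by
  set s : Fin (d + 1) → ℝ := fun j =>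
    ∑ i, m i * (((Pi.single j 1 : Fin (d + 1) → ℝ) i.succ - (Pi.single j 1 : Fin (d + 1) → ℝ) 0) /
      (d + 1 : ℕ))
  have h1 : ∀ p : Fin (d + 1) × Fin (d + 1),
      ∑ i, m i * (rootVec' (d := d) p i / (d + 1 : ℕ)) = s p.1 - s p.2 := by
    intro p
    simp only [s, ← Finset.sum_sub_distrib, rootVec', rootVec, Pi.sub_apply]
    exact Finset.sum_congr rfl fun i _ => by ring
  have h2 : ∀ i j, ∃ N : ℤ, s i - s j = N := by
    intro i j
    let e : Fin (d + 1) → ℤ := Pi.single i 1 - Pi.single j 1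
    have hdvd : ((d + 1 : ℕ) : ℤ) ∣ ∑ l : Fin d, (e l.succ - e 0) := by
      have h3 : ∑ l, e l = 0 := by simp [e]
      rw [Fin.sum_univ_succ] at h3
      rw [Finset.sum_sub_distrib, Finset.sum_const, Finset.card_univ, Fintype.card_fin,
        nsmul_eq_mul, eq_neg_of_add_eq_zero_right h3]
      exact ⟨- e 0, by push_cast; ring⟩
    obtain ⟨N, hN⟩ := h (fun l => e l.succ - e 0) hdvd
    refine ⟨N, ?_⟩
    rw [← h1 (i, j), ← hN]
    refine Finset.sum_congr rfl fun l _ => ?_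
    simp only [rootVec', rootVec, e, Pi.sub_apply, Pi.single_apply]
    push_cast
    rfl
  have hd : (((d + 1 : ℕ) : ℝ)) ≠ 0 := by positivity
  have h3 : ∀ l : Fin d, s l.succ = m l / (d + 1 : ℕ) := by
    intro l
    simp only [s, Pi.single_apply, Fin.succ_inj, (Fin.succ_ne_zero l).symm, if_false, sub_zero,
      ite_div, zero_div, mul_ite, mul_zero, Finset.sum_ite_eq', Finset.mem_univ, if_true]
    ring
  have h4 : s 0 = -(∑ l, (m l : ℝ)) / (d + 1 : ℕ) := by
    simp only [s, Pi.single_apply, Fin.succ_ne_zero, if_false, if_true]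
    rw [← Finset.sum_mul]
    ring
  -- If `s` were constant, each `m l` would equal `-∑ m`; summing gives `(d + 1) ∑ m = 0`, hence `m
  -- = 0`.
  have h5 : ∃ l : Fin d, s l.succ ≠ s 0 := by
    by_contra! hcon
    apply hm
    have h6 : ∀ l, (m l : ℝ) = -∑ l, (m l : ℝ) := by
      intro l
      have := hcon l
      rw [h3, h4] at this
      exact (div_left_inj' hd).1 this
    have h7 : ∑ l, (m l : ℝ) = d * -∑ l, (m l : ℝ) := by
      conv_lhs => rw [Finset.sum_congr rfl fun l _ => h6 l]
      simp
    have h8 : ∑ l, (m l : ℝ) = 0 := by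
      have : ((d : ℝ) + 1) * ∑ l, (m l : ℝ) = 0 := by linarith
      rcases mul_eq_zero.1 this with h9 | h9
      · exact absurd h9 (by positivity)
      · exact h9
    funext l
    have := h6 l
    rw [h8, neg_zero] at this
    exact_mod_cast this
  obtain ⟨l, hl⟩ := h5
  have h6 := two_mul_le_sum_sq_sub s h2 l.succ 0 hl
  simp only [h1, mul_pow]
  rw [← Finset.mul_sum, Fintype.sum_prod_type]
  nlinarith [sq_nonneg Real.pi, mul_le_mul_of_nonneg_left h6 (sq_nonneg Real.pi)]

lemma continuous_alcoveFold {E : Type*} [NormedAddCommGroup E] [NormedSpace ℝ E]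
    (v : Fin (d + 1) → E) : Continuous (alcoveFold v) := by
  have : LipschitzWith (Real.toNNReal (2 * ∑ i, ‖v i‖)) (alcoveFold v) := by
    refine LipschitzWith.of_dist_le_mul fun x x' => ?_
    rw [dist_eq_norm, dist_eq_norm, Real.coe_toNNReal _ (by positivity)]
    refine (alcoveFold.norm_sub_le v (r := ‖x - x'‖) fun i => norm_le_pi_norm (x - x') i).trans ?_
    rw [mul_right_comm]
  exact this.continuous

/-- `rootVec'` and `rootVec` differ by a multiple of the diagonal, which the folding ignores. -/
lemma alcoveFold_cons_add_rootVec' {E : Type*} [NormedAddCommGroup E] [NormedSpace ℝ E]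
    (v : Fin (d + 1) → E) (y : Fin d → ℝ) (t : ℝ) (p : Fin (d + 1) × Fin (d + 1)) :
    alcoveFold v (Fin.cons 0 (y + t • rootVec' p) : Fin (d + 1) → ℝ) =
      alcoveFold v ((Fin.cons 0 y : Fin (d + 1) → ℝ) + t • rootVec p) := by
  rw [← alcoveFold.add_const v (Fin.cons 0 (y + t • rootVec' p) : Fin (d + 1) → ℝ)
    (t * rootVec p 0)]
  congr 1
  funext j
  refine Fin.cases ?_ (fun l => ?_) j
  · simp
  · simp [rootVec']; ring

/-- A point of a cell is a permuted integer translate of a point of the fundamental alcove: the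
translation rotates the vertices, and undoing the permutation permutes the displacement `δ`. -/
lemma alcoveFold_cell {E : Type*} [NormedAddCommGroup E] [NormedSpace ℝ E]
    (v : Fin (d + 1) → E) (y : Fin d → ℝ) (σ : Equiv.Perm (Fin d)) (k : Fin d → ℕ)
    (δ : Fin (d + 1) → ℝ) :
    alcoveFold v ((Fin.cons 0 (fun i => y (σ i) + k i) : Fin (d + 1) → ℝ) + δ) =
      alcoveFold (v ∘ ⇑((finRotate (d + 1)).symm ^ (∑ i, k i)))
        ((Fin.cons 0 y : Fin (d + 1) → ℝ) + δ ∘ (Equiv.Perm.decomposeFin.symm (0, σ)).symm) := by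
  set τ := Equiv.Perm.decomposeFin.symm (0, σ)
  have h1 : ((Fin.cons 0 (fun i => y (σ i) + k i) : Fin (d + 1) → ℝ) + δ) =
      fun j => (((Fin.cons 0 y : Fin (d + 1) → ℝ) + δ ∘ τ.symm) ∘ τ) j +
        ((Fin.cons 0 (fun i => (k i : ℤ)) : Fin (d + 1) → ℤ) j : ℝ) := by
    funext j
    have hτ0 : τ 0 = 0 := by simp [τ]
    have hτs : ∀ l, τ (Fin.succ l) = (σ l).succ := fun l => by simp [τ]
    simp only [Pi.add_apply, Function.comp, Equiv.symm_apply_apply]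
    refine Fin.cases ?_ (fun l => ?_) j
    · simp [hτ0]
    · simp only [hτs, Fin.cons_succ, Int.cast_natCast]
      ring
  rw [h1, alcoveFold.add_int v _ _ (∑ i, k i) (by simp [Fin.sum_univ_succ]), alcoveFold.comp_perm]

lemma rootVec_comp_symm (p : Fin (d + 1) × Fin (d + 1)) (τ : Equiv.Perm (Fin (d + 1))) :
    rootVec p ∘ τ.symm = rootVec (τ p.1, τ p.2) := by
  funext l
  simp only [rootVec, Function.comp, Pi.sub_apply, Pi.single_apply, Equiv.symm_apply_eq]

/-- Small displacements stay in the open alcove, where the folding is affine; a root changes two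
coordinates, hence the difference of two cyclic edges. -/
lemma alcoveFold_eq_kuhnParam_add {E : Type*} [NormedAddCommGroup E] [NormedSpace ℝ E]
    (v : Fin (d + 1) → E) {y : Fin d → ℝ} (hy : y ∈ kuhnSimplex d)
    (p : Fin (d + 1) × Fin (d + 1)) :
    ∀ᶠ t : ℝ in 𝓝 0, alcoveFold v ((Fin.cons 0 y : Fin (d + 1) → ℝ) + t • rootVec p) =
      kuhnParam v y + t • (cyclicEdge v p.1 - cyclicEdge v p.2) := by
  set x : Fin (d + 1) → ℝ := Fin.cons 0 y
  have hmono : ∀ l : Fin d, x l.castSucc < x l.succ := by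
    intro l
    have := (cyclicGap_pos_iff y).2 hy l.castSucc
    rw [finRotate_apply, Fin.coeSucc_eq_succ, if_neg (Fin.castSucc_lt_last l).ne] at this
    linarith
  have hlast : x (Fin.last d) < x 0 + 1 := by
    have := (cyclicGap_pos_iff y).2 hy (Fin.last d)
    rw [finRotate_last, if_pos rfl] at this
    linarith
  have hc : ∀ i, Continuous fun t : ℝ => (x + t • rootVec p) i := fun i => by
    simp only [Pi.add_apply, Pi.smul_apply]; fun_prop
  have h1 : ∀ᶠ t : ℝ in 𝓝 0, ∀ l : Fin d,
      (x + t • rootVec p) l.castSucc < (x + t • rootVec p) l.succ :=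
    eventually_all.2 fun l => (hc _).continuousAt.eventually_lt (hc _).continuousAt
      (by simpa using hmono l)
  have h2 : ∀ᶠ t : ℝ in 𝓝 0, (x + t • rootVec p) (Fin.last d) < (x + t • rootVec p) 0 + 1 :=
    (hc _).continuousAt.eventually_lt ((hc _).add continuous_const).continuousAt
      (by simpa using hlast)
  filter_upwards [h1, h2] with t ht1 ht2
  rw [alcoveFold.eq_affine v (Fin.strictMono_iff_lt_succ.2 ht1).monotone ht2.le]
  simp only [Pi.add_apply, Pi.smul_apply, add_smul, Finset.sum_add_distrib, smul_assoc,
    ← Finset.smul_sum]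
  have := sum_smul_rootVec (cyclicEdge v) p
  simp only [cyclicEdge] at this
  rw [this, kuhnParam, ← add_assoc]
  rfl

lemma kuhnSimplex_subset_Icc : kuhnSimplex d ⊆ Set.Icc 0 1 :=
  fun _ hy => ⟨fun i => (hy.2 i).1.le, fun i => (hy.2 i).2.le⟩

lemma volume_kuhnSimplex_lt_top : volume (kuhnSimplex d) < ⊤ :=
  (measure_mono kuhnSimplex_subset_Icc).trans_lt isCompact_Icc.measure_lt_top

/-- Dominated convergence: the quotients converge pointwise on the open alcove, away from the kinks
of the folding, and are bounded by the Lipschitz constants of `f` and of the folding. -/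
lemma tendsto_integral_kuhn_difference_quotient {E : Type*} [NormedAddCommGroup E]
    [NormedSpace ℝ E] (v : Fin (d + 1) → E) {f : E → ℝ} (hf : ContDiff ℝ 1 f) {C : NNReal}
    (hC : LipschitzWith C f) (p : Fin (d + 1) × Fin (d + 1)) :
    Tendsto (fun t : ℝ => (∫ y in kuhnSimplex d,
        (f (alcoveFold v ((Fin.cons 0 y : Fin (d + 1) → ℝ) + t • rootVec p)) -
          f (alcoveFold v (Fin.cons 0 y : Fin (d + 1) → ℝ))) ^ 2) / t ^ 2) (𝓝[≠] 0)
      (𝓝 (∫ y in kuhnSimplex d,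
        (fderiv ℝ f (kuhnParam v y) (cyclicEdge v p.1 - cyclicEdge v p.2)) ^ 2)) := by
  have := continuous_alcoveFold v
  have hfc := hf.continuous
  simp only [← integral_div]
  refine tendsto_integral_filter_of_dominated_convergence
    (fun _ => (C * (2 * ∑ i, ‖v i‖)) ^ 2) ?_ ?_ ?_ ?_
  · exact Eventually.of_forall fun t => Continuous.aestronglyMeasurable (by fun_prop)
  · refine eventually_nhdsWithin_of_forall fun t (ht : t ≠ 0) => Eventually.of_forall fun y => ?_
    rw [Real.norm_eq_abs, abs_of_nonneg (by positivity), ← div_pow]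
    refine sq_le_sq' ?_ ?_ <;> [skip; skip]
    all_goals
      have h1 := hC.dist_le_mul
        (alcoveFold v ((Fin.cons 0 y : Fin (d + 1) → ℝ) + t • rootVec p))
        (alcoveFold v (Fin.cons 0 y : Fin (d + 1) → ℝ))
      have h2 := alcoveFold.norm_sub_le v
        (x := (Fin.cons 0 y : Fin (d + 1) → ℝ) + t • rootVec p)
        (x' := (Fin.cons 0 y : Fin (d + 1) → ℝ)) (r := |t|) (fun i => by
          simp only [Pi.add_apply, Pi.smul_apply, add_sub_cancel_left, smul_eq_mul, abs_mul]
          exact mul_le_of_le_one_right (abs_nonneg _) (abs_rootVec_le p i))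
      rw [Real.dist_eq, dist_eq_norm] at h1
      have h3 := h1.trans (mul_le_mul_of_nonneg_left h2 C.2)
      have h4 : |(f (alcoveFold v ((Fin.cons 0 y : Fin (d + 1) → ℝ) + t • rootVec p)) -
          f (alcoveFold v (Fin.cons 0 y : Fin (d + 1) → ℝ))) / t| ≤
          C * (2 * ∑ i, ‖v i‖) := by
        rw [abs_div, div_le_iff₀ (abs_pos.2 ht)]
        refine h3.trans (le_of_eq ?_)
        ring
      first
        | exact (abs_le.1 h4).1
        | exact (abs_le.1 h4).2
  · exact integrableOn_const (volume_kuhnSimplex_lt_top.ne)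
  · refine (ae_restrict_iff' (isOpen_kuhnSimplex d).measurableSet).2
      (Eventually.of_forall fun y hy => ?_)
    have h0 := alcoveFold_eq_kuhnParam_add v hy p
    have h00 : alcoveFold v (Fin.cons 0 y : Fin (d + 1) → ℝ) = kuhnParam v y := by
      simpa using h0.self_of_nhds
    have h1 := ((hf.differentiable one_ne_zero (kuhnParam v y)).hasFDerivAt.hasLineDerivAt
      (cyclicEdge v p.1 - cyclicEdge v p.2))
    have h2 := (hasDerivAt_iff_tendsto_slope_zero.1 h1).pow 2
    refine h2.congr' ?_
    filter_upwards [nhdsWithin_le_nhds h0] with t ht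
    rw [ht, h00]
    simp
    ring

open GrossPitaevskii in
/-- A Poincaré inequality on a simplex, in terms of the derivatives along the edges of a cyclic
ordering of its vertices. -/
theorem poincare_simplex_cyclic {v : Fin (d + 1) → Space d} (hv : AffineIndependent ℝ v)
    {f : Space d → ℝ} (hf : ContDiff ℝ 1 f) {C : NNReal} (hC : LipschitzWith C f) :
    8 * Real.pi ^ 2 * d * ((∫ x in convexHull ℝ (Set.range v), f x ^ 2) -
        (volume.real (convexHull ℝ (Set.range v)))⁻¹ *
          (∫ x in convexHull ℝ (Set.range v), f x) ^ 2) ≤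
      ∫ x in convexHull ℝ (Set.range v), ∑ p : Fin (d + 1) × Fin (d + 1),
        (fderiv ℝ f x (cyclicEdge v p.1 - cyclicEdge v p.2)) ^ 2 := by
  set K := convexHull ℝ (Set.range v)
  have hfc := hf.continuous
  have hfd := hf.continuous_fderiv one_ne_zero
  have hKc : IsCompact K := (Set.finite_range v).isCompact_convexHull ℝ
  let P := (Fin d → Fin (d + 1)) × Equiv.Perm (Fin d)
  let ρ : P → Equiv.Perm (Fin (d + 1)) := fun p => (finRotate (d + 1)).symm ^ (∑ i, (p.1 i : ℕ))
  let w : P → Fin (d + 1) → Space d := fun p => v ∘ ⇑(ρ p)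
  have hw : ∀ p, AffineIndependent ℝ (w p) := fun p => hv.comp_embedding (ρ p).toEmbedding
  have hwK : ∀ p, convexHull ℝ (Set.range (w p)) = K := fun p => by
    simp only [w, EquivLike.range_comp, K]
  choose c hc using fun p => exists_setIntegral_kuhnParam (hw p)
  simp only [hwK] at hc
  set c₀ : ℝ := ∑ p : P, (((d + 1 : ℕ) : ℝ) ^ d)⁻¹ * c p
  -- the integral over the unit cube of a function of the folded variable
  have hcube : ∀ Ψ : Space d → ℝ, Continuous Ψ →
      ∫ z : Fin d → ℝ in {z | ∀ i, z i ∈ Set.Ioc (0 : ℝ) 1},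
        Ψ (alcoveFold v (Fin.cons 0 (((d + 1 : ℕ) : ℝ) • z) : Fin (d + 1) → ℝ)) = c₀ * ∫ x in K, Ψ x := by
    intro Ψ hΨ
    have hfold := continuous_alcoveFold v
    rw [integral_unitCube_eq_sum (n := d + 1) (Nat.succ_pos d)
      (Φ := fun y => Ψ (alcoveFold v (Fin.cons 0 y : Fin (d + 1) → ℝ))) (by fun_prop), Finset.sum_mul]
    refine Finset.sum_congr rfl fun p _ => ?_
    rw [mul_assoc, ← hc p]
    congr 1
    refine setIntegral_congr_fun (isOpen_kuhnSimplex d).measurableSet fun y hy => ?_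
    have h1 := alcoveFold_cell v y p.2.symm (fun i => (p.1 i : ℕ)) 0
    have h2 := (alcoveFold_eq_kuhnParam_add (w p) hy (0, 0)).self_of_nhds
    simp only [add_zero, Pi.zero_comp, zero_smul] at h1 h2
    simp only [h1]
    exact congrArg Ψ h2
  -- The cube has volume `1`, so `Ψ = 1` determines the Jacobian sum.
  have hvol : c₀ * volume.real K = 1 := by
    have h1 := hcube (fun _ => 1) continuous_const
    simp only [setIntegral_const, smul_eq_mul, mul_one] at h1
    rw [← h1]
    have h2 : {z : Fin d → ℝ | ∀ i, z i ∈ Set.Ioc (0 : ℝ) 1} =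
        Set.univ.pi fun _ => Set.Ioc (0 : ℝ) 1 := by
      ext z; simp
    rw [h2, measureReal_def, Real.volume_pi_Ioc]
    simp
  have hKpos : 0 < volume.real K := lt_of_le_of_ne measureReal_nonneg fun h => by
    rw [← h, mul_zero] at hvol; exact zero_ne_one hvol
  have hc₀ : c₀ = (volume.real K)⁻¹ := eq_inv_of_mul_eq_one_left hvol
  set R := ∑ p : P, (((d + 1 : ℕ) : ℝ) ^ d)⁻¹ * ∑ q : Fin (d + 1) × Fin (d + 1), ∫ y in kuhnSimplex d,
    (fderiv ℝ f (kuhnParam (w p) y) (cyclicEdge (w p) q.1 - cyclicEdge (w p) q.2)) ^ 2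
  have hfold := continuous_alcoveFold v
  have key := UnitAddTorus.poincare_of_periodic (n := d + 1) (Nat.succ_pos d)
    (U := fun y => f (alcoveFold v (Fin.cons 0 y : Fin (d + 1) → ℝ))) (by fun_prop) ?_
    (rootVec' (d := d)) (8 * Real.pi ^ 2 * d) R (fun m hm h => le_sum_rootVec' m hm h) ?_
  · rw [hcube (fun x => f x ^ 2) (by fun_prop), hcube f hfc] at key
    -- Rotating the vertices rotates the cyclic edges, and the sum over all pairs of edges is
    -- unchanged.
    have hR : R = c₀ * ∫ x in K, ∑ p : Fin (d + 1) × Fin (d + 1),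
        (fderiv ℝ f x (cyclicEdge v p.1 - cyclicEdge v p.2)) ^ 2 := by
      simp only [R, c₀, Finset.sum_mul]
      refine Finset.sum_congr rfl fun p _ => ?_
      rw [mul_assoc]
      congr 1
      have hcyc : ∀ i, cyclicEdge (w p) i = cyclicEdge v (ρ p i) := by
        intro i
        have : ρ p ((finRotate (d + 1)).symm i) = (finRotate (d + 1)).symm (ρ p i) := by
          simp only [ρ, ← Equiv.Perm.mul_apply, ← pow_succ, ← pow_succ']
        simp only [cyclicEdge, w, Function.comp]
        rw [this]
      have h1 : ∀ q : Fin (d + 1) × Fin (d + 1), ∫ y in kuhnSimplex d, (fderiv ℝ f (kuhnParam (w p) y)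
          (cyclicEdge (w p) q.1 - cyclicEdge (w p) q.2)) ^ 2 = c p * ∫ x in K,
            (fderiv ℝ f x (cyclicEdge v (ρ p q.1) - cyclicEdge v (ρ p q.2))) ^ 2 := by
        intro q
        rw [hcyc, hcyc]
        exact hc p fun x => (fderiv ℝ f x _) ^ 2
      simp only [h1]
      rw [← Finset.mul_sum, integral_finsetSum]
      · congr 1
        exact Equiv.sum_comp ((ρ p).prodCongr (ρ p)) fun q : Fin (d + 1) × Fin (d + 1) => ∫ x in K,
          (fderiv ℝ f x (cyclicEdge v q.1 - cyclicEdge v q.2)) ^ 2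
      · intro q _
        exact (show Continuous fun x => (fderiv ℝ f x (cyclicEdge v q.1 - cyclicEdge v q.2)) ^ 2
          by fun_prop).continuousOn.integrableOn_compact hKc
    rw [hR, hc₀] at key
    have h2 : 0 < (volume.real K)⁻¹ := inv_pos.2 hKpos
    refine le_of_mul_le_mul_left (le_trans (le_of_eq ?_) key) h2
    ring
  -- Since `∑ k = (d + 1) q`, subtracting the constant `q` from `(0, k)` leaves an integer vector of
  -- sum `0`, which does not rotate the vertices.
  · intro k ⟨q, hq⟩ y
    have h1 := alcoveFold.add_const v (fun j => (Fin.cons 0 y : Fin (d + 1) → ℝ) j +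
      ((((Fin.cons 0 k : Fin (d + 1) → ℤ) j - q : ℤ)) : ℝ)) q
    have h2 := alcoveFold.add_int v (Fin.cons 0 y : Fin (d + 1) → ℝ)
      (fun j => (Fin.cons 0 k : Fin (d + 1) → ℤ) j - q) 0 (by
        rw [Finset.sum_sub_distrib, Finset.sum_const, Finset.card_univ, Fintype.card_fin,
          Fin.sum_univ_succ]
        simp only [Fin.cons_zero, Fin.cons_succ, hq, nsmul_eq_mul]
        push_cast
        ring)
    rw [h2] at h1
    have h3 : (fun j => (Fin.cons 0 y : Fin (d + 1) → ℝ) j +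
        ((((Fin.cons 0 k : Fin (d + 1) → ℤ) j - q : ℤ)) : ℝ) + q) =
        (Fin.cons 0 (y + fun i => (k i : ℝ)) : Fin (d + 1) → ℝ) := by
      funext j
      refine Fin.cases ?_ (fun l => ?_) j
      · simp
      · simp; ring
    rw [h3] at h1
    simp only [h1]
    simp
  · have hlim : Tendsto (fun t : ℝ => ∑ p : P, (((d + 1 : ℕ) : ℝ) ^ d)⁻¹ * ∑ q : Fin (d + 1) × Fin (d + 1),
        (∫ y in kuhnSimplex d,
        (f (alcoveFold (w p) ((Fin.cons 0 y : Fin (d + 1) → ℝ) + t • rootVec q)) -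
          f (alcoveFold (w p) (Fin.cons 0 y : Fin (d + 1) → ℝ))) ^ 2) / t ^ 2) (𝓝[≠] 0) (𝓝 R) :=
      tendsto_finsetSum _ fun p _ => (tendsto_finsetSum _ fun q _ =>
        tendsto_integral_kuhn_difference_quotient (w p) hf hC q).const_mul _
    refine hlim.congr fun t => ?_
    have h1 : ∀ q : Fin (d + 1) × Fin (d + 1), ∫ z : Fin d → ℝ in {z | ∀ i, z i ∈ Set.Ioc (0 : ℝ) 1},
        (f (alcoveFold v (Fin.cons 0 (((d + 1 : ℕ) : ℝ) • z + t • rootVec' q) : Fin (d + 1) → ℝ)) -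
          f (alcoveFold v (Fin.cons 0 (((d + 1 : ℕ) : ℝ) • z) : Fin (d + 1) → ℝ))) ^ 2 =
        ∑ p : P, (((d + 1 : ℕ) : ℝ) ^ d)⁻¹ * ∫ y in kuhnSimplex d,
          (f (alcoveFold (w p) ((Fin.cons 0 y : Fin (d + 1) → ℝ) + t • rootVec
            (Equiv.Perm.decomposeFin.symm (0, p.2.symm) q.1,
              Equiv.Perm.decomposeFin.symm (0, p.2.symm) q.2))) -
          f (alcoveFold (w p) (Fin.cons 0 y : Fin (d + 1) → ℝ))) ^ 2 := by
      intro q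
      rw [integral_unitCube_eq_sum (n := d + 1) (Nat.succ_pos d)
        (Φ := fun y => (f (alcoveFold v (Fin.cons 0 (y + t • rootVec' q) : Fin (d + 1) → ℝ)) -
          f (alcoveFold v (Fin.cons 0 y : Fin (d + 1) → ℝ))) ^ 2) (by fun_prop)]
      refine Finset.sum_congr rfl fun p _ => ?_
      congr 1
      refine integral_congr_ae (Eventually.of_forall fun y => ?_)
      have h2 := alcoveFold_cell v y p.2.symm (fun i => (p.1 i : ℕ)) 0
      have h3 := alcoveFold_cell v y p.2.symm (fun i => (p.1 i : ℕ)) (t • rootVec q)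
      rw [Pi.smul_comp, rootVec_comp_symm] at h3
      simp only [add_zero, Pi.zero_comp] at h2
      simp only [alcoveFold_cons_add_rootVec', h2, h3]
      rfl
    simp only [h1]
    -- In each cell the roots appear permuted; summing over all of them removes the permutation.
    rw [Finset.sum_comm, Finset.sum_div]
    refine Finset.sum_congr rfl fun p _ => ?_
    rw [← Finset.mul_sum, mul_div_assoc, Finset.sum_div]
    congr 1
    exact (Equiv.sum_comp ((Equiv.Perm.decomposeFin.symm (0, p.2.symm)).prodCongr
      (Equiv.Perm.decomposeFin.symm (0, p.2.symm))) fun q : Fin (d + 1) × Fin (d + 1) =>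
        (∫ y in kuhnSimplex d,
          (f (alcoveFold (w p) ((Fin.cons 0 y : Fin (d + 1) → ℝ) + t • rootVec q)) -
          f (alcoveFold (w p) (Fin.cons 0 y : Fin (d + 1) → ℝ))) ^ 2) / t ^ 2).symm

end SimplexFourier

/-! ### The Poincaré constant `h / π` in dimensions one to three. -/

section SimplexPoincare

/-- Subtracting `min w + H / 2` puts all values in `[-H/2, H/2]`. The double sum is `2(n + 1) ∑ u² -
2 (∑ u)²`, and the last term can be dropped. -/
lemma sum_sq_sub_le_of_abs_sub_le {n : ℕ} (w : Fin (n + 1) → ℝ) {H : ℝ}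
    (hH : ∀ i j, |w i - w j| ≤ H) :
    ∑ i, ∑ j, (w i - w j) ^ 2 ≤ (n + 1) ^ 2 * H ^ 2 / 2 := by
  obtain ⟨i₀, hi₀⟩ := Finite.exists_min w
  let u : Fin (n + 1) → ℝ := fun i => w i - w i₀ - H / 2
  have h1 : ∀ i, u i ^ 2 ≤ H ^ 2 / 4 := by
    intro i
    have h2 := (abs_le.1 (hH i i₀)).2
    have h3 := hi₀ i
    simp only [u]
    nlinarith
  have h2 : ∑ i, ∑ j, (w i - w j) ^ 2 = 2 * (n + 1) * (∑ i, u i ^ 2) - 2 * (∑ i, u i) ^ 2 := by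
    have h3 : ∀ i j, (w i - w j) ^ 2 = (u i - u j) ^ 2 := fun i j => by simp only [u]; ring
    simp only [h3, sub_sq, Finset.sum_add_distrib, Finset.sum_sub_distrib, Finset.sum_const,
      Finset.card_univ, Fintype.card_fin, nsmul_eq_mul, ← Finset.mul_sum, ← Finset.sum_mul]
    push_cast
    ring
  have h3 : ∑ i, u i ^ 2 ≤ (n + 1) * (H ^ 2 / 4) := by
    have := Finset.sum_le_card_nsmul Finset.univ (fun i => u i ^ 2) _ fun i _ => h1 i
    simpa using this
  rw [h2]
  have hn : (0 : ℝ) ≤ 2 * (n + 1) := by positivity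
  nlinarith [mul_le_mul_of_nonneg_left h3 hn, sq_nonneg (∑ i, u i)]

/-- The sum of the squares of the differences of the cyclic edges. -/
def cyclicForm {d : ℕ} (w : Fin (d + 1) → ℝ) : ℝ :=
  ∑ p : Fin (d + 1) × Fin (d + 1), (cyclicEdge w p.1 - cyclicEdge w p.2) ^ 2

lemma cyclicForm_one (w : Fin 2 → ℝ) :
    cyclicForm (d := 1) w = 4 * ∑ i, ∑ j, (w i - w j) ^ 2 := by
  have e0 : (finRotate 2).symm 0 = 1 := by decide
  have e1 : (finRotate 2).symm 1 = 0 := by decide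
  have h : cyclicForm (d := 1) w = ∑ i : Fin 2, ∑ j : Fin 2, (w ((finRotate 2).symm i) - w i -
      (w ((finRotate 2).symm j) - w j)) ^ 2 := Fintype.sum_prod_type _
  simp only [h, Fin.sum_univ_two, e0, e1]
  ring

lemma cyclicForm_two (w : Fin 3 → ℝ) :
    cyclicForm (d := 2) w = 3 * ∑ i, ∑ j, (w i - w j) ^ 2 := by
  have e0 : (finRotate 3).symm 0 = 2 := by decide
  have e1 : (finRotate 3).symm 1 = 0 := by decide
  have e2 : (finRotate 3).symm 2 = 1 := by decide
  have h : cyclicForm (d := 2) w = ∑ i : Fin 3, ∑ j : Fin 3, (w ((finRotate 3).symm i) - w i -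
      (w ((finRotate 3).symm j) - w j)) ^ 2 := Fintype.sum_prod_type _
  simp only [h, Fin.sum_univ_three, e0, e1, e2]
  ring

/-- Cyclic edges sum to zero, so each form is `8` times the sum of its squared edges. The three
orders are the cyclic orders of four points up to reversal, and every pair is adjacent in exactly
two of them. -/
lemma cyclicForm_three (w : Fin 4 → ℝ) :
    cyclicForm (d := 3) w + cyclicForm (d := 3) (w ∘ Equiv.swap 1 2) +
      cyclicForm (d := 3) (w ∘ Equiv.swap 2 3) = 8 * ∑ i, ∑ j, (w i - w j) ^ 2 := by
  have e0 : (finRotate 4).symm 0 = 3 := by decide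
  have e1 : (finRotate 4).symm 1 = 0 := by decide
  have e2 : (finRotate 4).symm 2 = 1 := by decide
  have e3 : (finRotate 4).symm 3 = 2 := by decide
  have s0 : Equiv.swap (1 : Fin 4) 2 0 = 0 := by decide
  have s3 : Equiv.swap (1 : Fin 4) 2 3 = 3 := by decide
  have t0 : Equiv.swap (2 : Fin 4) 3 0 = 0 := by decide
  have t1 : Equiv.swap (2 : Fin 4) 3 1 = 1 := by decide
  have h (w : Fin 4 → ℝ) : cyclicForm (d := 3) w = ∑ i : Fin 4, ∑ j : Fin 4,
      (w ((finRotate 4).symm i) - w i - (w ((finRotate 4).symm j) - w j)) ^ 2 :=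
    Fintype.sum_prod_type _
  simp only [h, Fin.sum_univ_four, e0, e1, e2, e3, Function.comp, s0, s3, t0, t1, Equiv.swap_apply_left, Equiv.swap_apply_right]
  ring

open GrossPitaevskii

variable {d : ℕ}

lemma abs_apply_sub_le {v : Fin (d + 1) → Space d} {h : ℝ} (hh : ∀ i j, dist (v i) (v j) ≤ h)
    (φ : Space d →L[ℝ] ℝ) (i j : Fin (d + 1)) : |φ (v i) - φ (v j)| ≤ ‖φ‖ * h := by
  rw [← map_sub]
  refine (φ.le_opNorm _).trans (mul_le_mul_of_nonneg_left ?_ (norm_nonneg _))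
  rw [← dist_eq_norm]
  exact hh i j

/-- The left side of `poincare_simplex_cyclic` does not see the order of the vertices, so the
inequality may be summed over several orders to symmetrise its right side. -/
lemma variance_mul_le_of_forall_sum_le {v : Fin (d + 1) → Space d} (hv : AffineIndependent ℝ v)
    {f : Space d → ℝ} (hf : ContDiff ℝ 1 f) {C : NNReal} (hC : LipschitzWith C f) {m : ℕ}
    (τ : Fin m → Equiv.Perm (Fin (d + 1))) {A : ℝ}
    (hA : ∀ φ : Space d →L[ℝ] ℝ, ∑ k, cyclicForm ((φ ∘ v) ∘ τ k) ≤ A * ‖φ‖ ^ 2) :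
    m * (8 * Real.pi ^ 2 * d * ((∫ x in convexHull ℝ (Set.range v), f x ^ 2) -
        (volume.real (convexHull ℝ (Set.range v)))⁻¹ *
          (∫ x in convexHull ℝ (Set.range v), f x) ^ 2)) ≤
      A * ∫ x in convexHull ℝ (Set.range v), ‖fderiv ℝ f x‖ ^ 2 := by
  have hfd := hf.continuous_fderiv one_ne_zero
  have hKc : IsCompact (convexHull ℝ (Set.range v)) := (Set.finite_range v).isCompact_convexHull ℝ
  have h1 := fun k : Fin m =>
    poincare_simplex_cyclic (hv.comp_embedding (τ k).toEmbedding) hf hC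
  simp only [Equiv.coe_toEmbedding, EquivLike.range_comp] at h1
  have h2 := Finset.sum_le_sum fun k (_ : k ∈ Finset.univ) => h1 k
  rw [Finset.sum_const, Finset.card_univ, Fintype.card_fin, nsmul_eq_mul,
    ← integral_finsetSum] at h2
  · refine h2.trans ?_
    rw [← integral_const_mul]
    exact setIntegral_mono_on
      ((show Continuous _ by fun_prop).continuousOn.integrableOn_compact hKc)
      ((show Continuous _ by fun_prop).continuousOn.integrableOn_compact hKc)
      hKc.measurableSet fun x _ => by
        refine le_trans (le_of_eq ?_) (hA (fderiv ℝ f x))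
        simp only [cyclicForm, cyclicEdge, map_sub, Function.comp]
  · intro k _
    exact (show Continuous _ by fun_prop).continuousOn.integrableOn_compact hKc

/-- The Poincaré inequality with the Payne-Weinberger constant on a simplex of dimension at
most three. -/
theorem poincare_simplex (hd : 1 ≤ d) (hd3 : d ≤ 3) {v : Fin (d + 1) → Space d}
    (hv : AffineIndependent ℝ v) {h : ℝ} (hh : ∀ i j, dist (v i) (v j) ≤ h)
    {f : Space d → ℝ} (hf : ContDiff ℝ 1 f) {C : NNReal} (hC : LipschitzWith C f) :
    (∫ x in convexHull ℝ (Set.range v), f x ^ 2) -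
        (volume.real (convexHull ℝ (Set.range v)))⁻¹ *
          (∫ x in convexHull ℝ (Set.range v), f x) ^ 2 ≤
      h ^ 2 / Real.pi ^ 2 * ∫ x in convexHull ℝ (Set.range v), ‖fderiv ℝ f x‖ ^ 2 := by
  have hpi : 0 < Real.pi ^ 2 := by positivity
  have hI : 0 ≤ h ^ 2 * ∫ x in convexHull ℝ (Set.range v), ‖fderiv ℝ f x‖ ^ 2 :=
    mul_nonneg (sq_nonneg _) (integral_nonneg fun x => sq_nonneg _)
  rw [div_mul_eq_mul_div, le_div_iff₀ hpi]
  obtain rfl | rfl | rfl : d = 1 ∨ d = 2 ∨ d = 3 := by omega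
  -- Here `4 · 2²/2 = 8` equals the factor `8d`, so there is no slack.
  · have key := variance_mul_le_of_forall_sum_le hv hf hC (m := 1) (A := 8 * h ^ 2)
      (fun _ => 1) (fun φ => ?_)
    · norm_num at key
      linarith
    · have h1 := sum_sq_sub_le_of_abs_sub_le (n := 1) (φ ∘ v) (abs_apply_sub_le hh φ)
      have h2 := cyclicForm_one (φ ∘ v)
      rw [Fin.sum_univ_one, Equiv.Perm.coe_one, Function.comp_id, h2]
      norm_num only at h1
      exact (mul_le_mul_of_nonneg_left h1 (by norm_num)).trans (by nlinarith)
  -- Here `3 · 3²/2 = 13.5` is at most `8d = 16`.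
  · have key := variance_mul_le_of_forall_sum_le hv hf hC (m := 1) (A := 16 * h ^ 2)
      (fun _ => 1) (fun φ => ?_)
    · norm_num at key
      linarith
    · have h1 := sum_sq_sub_le_of_abs_sub_le (n := 2) (φ ∘ v) (abs_apply_sub_le hh φ)
      have h2 := cyclicForm_two (φ ∘ v)
      rw [Fin.sum_univ_one, Equiv.Perm.coe_one, Function.comp_id, h2]
      norm_num only at h1
      have h3 : 0 ≤ (‖φ‖ * h) ^ 2 := sq_nonneg _
      exact (mul_le_mul_of_nonneg_left h1 (by norm_num)).trans (by nlinarith)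
  -- Here `8 · 4²/2 = 64`, at most three times `8d = 24`.
  · have key := variance_mul_le_of_forall_sum_le hv hf hC (m := 3) (A := 64 * h ^ 2)
      ![1, Equiv.swap 1 2, Equiv.swap 2 3] (fun φ => ?_)
    · norm_num at key
      linarith
    · have h1 := sum_sq_sub_le_of_abs_sub_le (n := 3) (φ ∘ v) (abs_apply_sub_le hh φ)
      have h2 := cyclicForm_three (φ ∘ v)
      rw [Fin.sum_univ_three]
      refine (le_of_eq h2).trans ?_
      norm_num only at h1
      exact (mul_le_mul_of_nonneg_left h1 (by norm_num)).trans (by nlinarith)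

end SimplexPoincare

/-! ### Measure theory of the mesh. -/

namespace GrossPitaevskii

namespace SimplicialMesh

variable {d : ℕ} {Ω : Set (Space d)}

/-- The closed simplex with vertex set `s`. -/
abbrev simplex (s : Finset (Space d)) : Set (Space d) := convexHull ℝ (s : Set (Space d))

lemma isCompact_simplex (s : Finset (Space d)) : IsCompact (simplex s) :=
  s.finite_toSet.isCompact_convexHull ℝ

lemma measurableSet_simplex (s : Finset (Space d)) : MeasurableSet (simplex s) :=
  (isCompact_simplex s).measurableSet

lemma interior_simplex_ae_eq (s : Finset (Space d)) :
    (interior (simplex s) : Set (Space d)) =ᵐ[volume] simplex s :=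
  interior_ae_eq_of_null_frontier
    ((convex_convexHull ℝ (s : Set (Space d))).addHaar_frontier (μ := volume))

instance isFiniteMeasure_restrict_simplex (s : Finset (Space d)) :
    IsFiniteMeasure (volume.restrict (simplex s)) :=
  ⟨by rw [Measure.restrict_apply_univ]; exact (isCompact_simplex s).measure_lt_top⟩

/-- An enumeration of the vertices of an element. -/
lemma exists_vertices (T : SimplicialMesh Ω) {s : Finset (Space d)} (hs : s ∈ T.elements) :
    ∃ v : Fin (d + 1) → Space d, AffineIndependent ℝ v ∧ Set.range v = s := by
  let e := (s.equivFinOfCardEq (T.card_eq s hs)).symm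
  refine ⟨fun i => e i, (T.indep s hs).comp_embedding e.toEmbedding, ?_⟩
  ext x
  constructor
  · rintro ⟨i, rfl⟩; exact (e i).2
  · intro hx; exact ⟨e.symm ⟨x, hx⟩, by simp⟩

lemma affineSpan_eq_top (T : SimplicialMesh Ω) {s : Finset (Space d)} (hs : s ∈ T.elements) :
    affineSpan ℝ (s : Set (Space d)) = ⊤ := by
  obtain ⟨v, hv, hvs⟩ := T.exists_vertices hs
  rw [← hvs, hv.affineSpan_eq_top_iff_card_eq_finrank_add_one]
  simp

lemma interior_simplex_nonempty (T : SimplicialMesh Ω) {s : Finset (Space d)}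
    (hs : s ∈ T.elements) : (interior (simplex s)).Nonempty :=
  interior_convexHull_nonempty_iff_affineSpan_eq_top.2 (T.affineSpan_eq_top hs)

lemma volume_real_simplex_pos (T : SimplicialMesh Ω) {s : Finset (Space d)}
    (hs : s ∈ T.elements) : 0 < volume.real (simplex s) := by
  refine ENNReal.toReal_pos ?_ (isCompact_simplex s).measure_lt_top.ne
  exact ((isOpen_interior.measure_pos volume (T.interior_simplex_nonempty hs)).trans_le
    (measure_mono interior_subset)).ne'

lemma simplex_subset_closure (T : SimplicialMesh Ω) {s : Finset (Space d)}
    (hs : s ∈ T.elements) : simplex s ⊆ closure Ω := by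
  rw [← T.cover]
  exact Set.subset_biUnion_of_mem (u := fun s : Finset (Space d) => simplex s) hs

/-- An open convex set is the interior of its closure. -/
lemma interior_simplex_subset (T : SimplicialMesh Ω) (hΩ : IsOpen Ω) (hc : Convex ℝ Ω)
    (hne : Ω.Nonempty) {s : Finset (Space d)} (hs : s ∈ T.elements) :
    interior (simplex s) ⊆ Ω := by
  have h := hc.interior_closure_eq_interior_of_nonempty_interior (by rwa [hΩ.interior_eq])
  rw [hΩ.interior_eq] at h
  rw [← h]
  exact interior_mono (T.simplex_subset_closure hs)

/-- The common vertices omit some vertex of `s`, so by affine independence the intersection lies in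
a proper affine subspace. -/
lemma aedisjoint_simplex (T : SimplicialMesh Ω) {s t : Finset (Space d)}
    (hs : s ∈ T.elements) (ht : t ∈ T.elements) (hst : s ≠ t) :
    AEDisjoint volume (simplex s) (simplex t) := by
  refine measure_mono_null (T.inter_subset s hs t ht) ?_
  refine measure_mono_null (convexHull_subset_affineSpan (𝕜 := ℝ) _) ?_
  refine Measure.addHaar_affineSubspace volume _ fun htop => ?_
  have hnot : ¬ s ⊆ t := fun hsub =>
    hst (Finset.eq_of_subset_of_card_le hsub (by rw [T.card_eq s hs, T.card_eq t ht]))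
  obtain ⟨x, hxs, hxt⟩ := Finset.not_subset.1 hnot
  have h1 := (T.indep s hs).notMem_affineSpan_sdiff ⟨x, hxs⟩ Set.univ
  apply h1
  have h2 : (s : Set (Space d)) ∩ t ⊆
      (fun y : s => (y : Space d)) '' (Set.univ \ {⟨x, hxs⟩}) := by
    rintro y ⟨hys, hyt⟩
    refine ⟨⟨y, hys⟩, ⟨trivial, fun h => hxt ?_⟩, rfl⟩
    have h3 : y = x := congrArg Subtype.val h
    rw [← h3]; exact hyt
  exact affineSpan_mono ℝ h2 (by rw [htop]; trivial)

lemma ae_eq_biUnion (T : SimplicialMesh Ω) (hΩ : IsOpen Ω) (hc : Convex ℝ Ω) :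
    (Ω : Set (Space d)) =ᵐ[volume] ⋃ s : T.elements, simplex s.1 := by
  have h1 : (interior Ω : Set (Space d)) =ᵐ[volume] closure Ω :=
    (interior_ae_eq_of_null_frontier (hc.addHaar_frontier volume)).trans
      (closure_ae_eq_of_null_frontier (hc.addHaar_frontier volume)).symm
  rw [hΩ.interior_eq, ← T.cover] at h1
  have h2 : (⋃ s ∈ T.elements, convexHull ℝ (s : Set (Space d))) =
      ⋃ s : T.elements, simplex s.1 := by
    ext x; simp
  rwa [h2] at h1

lemma restrict_eq_sum (T : SimplicialMesh Ω) (hΩ : IsOpen Ω) (hc : Convex ℝ Ω) :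
    volume.restrict Ω = ∑ s ∈ T.elements, volume.restrict (simplex s) := by
  rw [Measure.restrict_congr_set (T.ae_eq_biUnion hΩ hc), Measure.restrict_iUnion_ae
    (fun s t hst => T.aedisjoint_simplex s.2 t.2 fun h => hst (Subtype.ext h))
    (fun s => (measurableSet_simplex s.1).nullMeasurableSet), Measure.sum_fintype]
  exact Finset.sum_coe_sort T.elements fun s => volume.restrict (simplex s)

lemma restrict_simplex_le (T : SimplicialMesh Ω) (hΩ : IsOpen Ω) (hc : Convex ℝ Ω)
    {s : Finset (Space d)} (hs : s ∈ T.elements) :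
    volume.restrict (simplex s) ≤ volume.restrict Ω := by
  rw [T.restrict_eq_sum hΩ hc]
  exact Finset.single_le_sum (f := fun s => volume.restrict (simplex s))
    (fun _ _ => Measure.zero_le _) hs

lemma ae_restrict_iff_forall (T : SimplicialMesh Ω) (hΩ : IsOpen Ω) (hc : Convex ℝ Ω)
    {p : Space d → Prop} : (∀ᵐ x ∂(volume.restrict Ω), p x) ↔
      ∀ s ∈ T.elements, ∀ᵐ x ∂(volume.restrict (simplex s)), p x := by
  rw [T.restrict_eq_sum hΩ hc, ae_finsetSum_measure_iff]

lemma ae_restrict_imp_iff (T : SimplicialMesh Ω) (hΩ : IsOpen Ω) (hc : Convex ℝ Ω)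
    {s : Finset (Space d)} (hs : s ∈ T.elements) {p : Space d → Prop} :
    (∀ᵐ x ∂(volume.restrict Ω), x ∈ simplex s → p x) ↔
      ∀ᵐ x ∂(volume.restrict (simplex s)), p x := by
  constructor
  · intro h
    have h1 := Measure.absolutelyContinuous_of_le (T.restrict_simplex_le hΩ hc hs) |>.ae_le h
    filter_upwards [h1, ae_restrict_mem (measurableSet_simplex s)] with x hx hxs using hx hxs
  · intro h
    exact ae_restrict_of_ae ((ae_restrict_iff' (measurableSet_simplex s)).1 h)

/-- The function which is given by `F s` on the element `s`. -/
noncomputable def piecewise {E : Type*} [AddCommMonoid E] (T : SimplicialMesh Ω)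
    (F : Finset (Space d) → Space d → E) (x : Space d) : E :=
  ∑ s ∈ T.elements, (simplex s).indicator (F s) x

lemma piecewise_ae_eq {E : Type*} [AddCommMonoid E] (T : SimplicialMesh Ω)
    (F : Finset (Space d) → Space d → E) {s : Finset (Space d)} (hs : s ∈ T.elements) :
    ∀ᵐ x ∂(volume.restrict (simplex s)), T.piecewise F x = F s x := by
  have h1 : ∀ t ∈ T.elements, t ≠ s → ∀ᵐ x ∂(volume.restrict (simplex s)), x ∉ simplex t := by
    intro t ht hts
    have h2 := T.aedisjoint_simplex ht hs hts
    rw [ae_iff]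
    simp only [not_not]
    exact (Measure.restrict_apply (measurableSet_simplex t)).trans h2
  have h3 := (ae_ball_iff (Finset.countable_toSet T.elements)
    (p := fun x t _ => t ≠ s → x ∉ simplex t)).2 fun t ht => by
      by_cases hts : t = s
      · exact Eventually.of_forall fun x h => absurd hts h
      · filter_upwards [h1 t ht hts] with x hx _ using hx
  filter_upwards [h3, ae_restrict_mem (measurableSet_simplex s)] with x hx hxs
  rw [piecewise, Finset.sum_eq_single_of_mem s hs fun t ht hts =>
    Set.indicator_of_notMem (hx t ht hts) _, Set.indicator_of_mem hxs]

lemma dist_le_meshSize (T : SimplicialMesh Ω) {s : Finset (Space d)} (hs : s ∈ T.elements)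
    {x y : Space d} (hx : x ∈ s) (hy : y ∈ s) : dist x y ≤ T.meshSize := by
  refine (Metric.dist_le_diam_of_mem (isCompact_simplex s).isBounded
    (subset_convexHull ℝ _ hx) (subset_convexHull ℝ _ hy)).trans ?_
  exact le_ciSup (f := fun s : T.elements => Metric.diam (simplex s.1))
    (Set.finite_range _).bddAbove ⟨s, hs⟩

end SimplicialMesh

end GrossPitaevskii

/-! ### Limits of inner products and norms in `L²`. -/

section L2

lemma tendsto_toLp {α E : Type*} [MeasurableSpace α] {ν : Measure α} [NormedAddCommGroup E]
    {f : ℕ → α → E} {g : α → E} (hf : ∀ n, MemLp (f n) 2 ν) (hg : MemLp g 2 ν)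
    (h : Tendsto (fun n => eLpNorm (fun x => f n x - g x) 2 ν) atTop (𝓝 0)) :
    Tendsto (fun n => (hf n).toLp (f n)) atTop (𝓝 (hg.toLp g)) := by
  rw [Lp.tendsto_Lp_iff_tendsto_eLpNorm']
  refine h.congr fun n => eLpNorm_congr_ae ?_
  filter_upwards [(hf n).coeFn_toLp, hg.coeFn_toLp] with x hx hx'
  rw [Pi.sub_apply, hx, hx']
variable {α : Type*} [MeasurableSpace α] {ν : Measure α} {E : Type*} [NormedAddCommGroup E]
  [InnerProductSpace ℝ E]

lemma inner_toLp_toLp {f g : α → E} (hf : MemLp f 2 ν) (hg : MemLp g 2 ν) :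
    inner ℝ (hf.toLp f) (hg.toLp g) = ∫ x, inner ℝ (f x) (g x) ∂ν := by
  rw [L2.inner_def]
  refine integral_congr_ae ?_
  filter_upwards [hf.coeFn_toLp, hg.coeFn_toLp] with x hx hx'
  rw [hx, hx']

lemma integrable_inner_of_memLp {f g : α → E} (hf : MemLp f 2 ν) (hg : MemLp g 2 ν) :
    Integrable (fun x => inner ℝ (f x) (g x)) ν := by
  refine (L2.integrable_inner (𝕜 := ℝ) (hf.toLp f) (hg.toLp g)).congr ?_
  filter_upwards [hf.coeFn_toLp, hg.coeFn_toLp] with x hx hx'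
  rw [hx, hx']

lemma tendsto_integral_inner {f : ℕ → α → E} {g k : α → E} (hf : ∀ n, MemLp (f n) 2 ν)
    (hg : MemLp g 2 ν) (hk : MemLp k 2 ν)
    (h : Tendsto (fun n => eLpNorm (fun x => f n x - g x) 2 ν) atTop (𝓝 0)) :
    Tendsto (fun n => ∫ x, inner ℝ (k x) (f n x) ∂ν) atTop (𝓝 (∫ x, inner ℝ (k x) (g x) ∂ν)) := by
  simp only [← inner_toLp_toLp hk (hf _), ← inner_toLp_toLp hk hg]
  exact tendsto_const_nhds.inner (tendsto_toLp hf hg h)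

lemma tendsto_integral_norm_sq {f : ℕ → α → E} {g : α → E} (hf : ∀ n, MemLp (f n) 2 ν)
    (hg : MemLp g 2 ν)
    (h : Tendsto (fun n => eLpNorm (fun x => f n x - g x) 2 ν) atTop (𝓝 0)) :
    Tendsto (fun n => ∫ x, ‖f n x‖ ^ 2 ∂ν) atTop (𝓝 (∫ x, ‖g x‖ ^ 2 ∂ν)) := by
  simp only [← real_inner_self_eq_norm_sq, ← inner_toLp_toLp (hf _) (hf _),
    ← inner_toLp_toLp hg hg]
  exact (tendsto_toLp hf hg h).inner (tendsto_toLp hf hg h)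

end L2

/-! ### Test functions and the elementwise Poincaré inequality in `H¹₀`. -/

namespace GrossPitaevskii

variable {d : ℕ} {Ω : Set (Space d)}

namespace IsTestFunction

variable {φ : Space d → ℝ}

lemma continuous_gradient (hφ : IsTestFunction Ω φ) : Continuous (gradient φ) :=
  (InnerProductSpace.toDual ℝ (Space d)).symm.continuous.comp
    (hφ.1.continuous_fderiv (by simp))

lemma hasCompactSupport_gradient (hφ : IsTestFunction Ω φ) : HasCompactSupport (gradient φ) :=
  (hφ.2.1.fderiv (𝕜 := ℝ)).comp_left (g := (InnerProductSpace.toDual ℝ (Space d)).symm)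
    (map_zero _)

lemma memLp (hφ : IsTestFunction Ω φ) (s : Set (Space d)) :
    MemLp φ 2 (volume.restrict s) :=
  (hφ.1.continuous.memLp_of_hasCompactSupport hφ.2.1).restrict s

lemma memLp_gradient (hφ : IsTestFunction Ω φ) (s : Set (Space d)) :
    MemLp (gradient φ) 2 (volume.restrict s) :=
  (hφ.continuous_gradient.memLp_of_hasCompactSupport hφ.hasCompactSupport_gradient).restrict s

end IsTestFunction

lemma norm_gradient (φ : Space d → ℝ) (x : Space d) : ‖gradient φ x‖ = ‖fderiv ℝ φ x‖ :=
  (InnerProductSpace.toDual ℝ (Space d)).symm.norm_map _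

/-- The Poincaré inequality on the elements of a mesh, for functions in `H¹₀(Ω)`. -/
theorem MemH10.poincare (hd : 1 ≤ d) (hd3 : d ≤ 3) (hΩ : IsOpen Ω) (hc : Convex ℝ Ω)
    (T : SimplicialMesh Ω) {v : Space d → ℝ} {g : Space d → Space d} (hv : MemH10 Ω v g)
    {s : Finset (Space d)} (hs : s ∈ T.elements) :
    (∫ x in SimplicialMesh.simplex s, v x ^ 2) - (volume.real (SimplicialMesh.simplex s))⁻¹ *
        (∫ x in SimplicialMesh.simplex s, v x) ^ 2 ≤
      T.meshSize ^ 2 / Real.pi ^ 2 * ∫ x in SimplicialMesh.simplex s, ‖g x‖ ^ 2 := by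
  obtain ⟨⟨hv2, hg2, -⟩, φ, hφ, hlim, hlim'⟩ := hv
  have hle := T.restrict_simplex_le hΩ hc hs
  have hv' := hv2.mono_measure hle
  have hg' := hg2.mono_measure hle
  have hl : Tendsto (fun n => eLpNorm (fun x => φ n x - v x) 2
      (volume.restrict (SimplicialMesh.simplex s))) atTop (𝓝 0) :=
    tendsto_of_tendsto_of_tendsto_of_le_of_le tendsto_const_nhds hlim (fun _ => zero_le)
      fun n => eLpNorm_mono_measure _ hle
  have hl' : Tendsto (fun n => eLpNorm (fun x => gradient (φ n) x - g x) 2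
      (volume.restrict (SimplicialMesh.simplex s))) atTop (𝓝 0) :=
    tendsto_of_tendsto_of_tendsto_of_le_of_le tendsto_const_nhds hlim' (fun _ => zero_le)
      fun n => eLpNorm_mono_measure _ hle
  have h1 := tendsto_integral_norm_sq (fun n => (hφ n).memLp _) hv' hl
  have h2 := tendsto_integral_norm_sq (fun n => (hφ n).memLp_gradient _) hg' hl'
  have h3 := tendsto_integral_inner (fun n => (hφ n).memLp _) hv' (memLp_const (1 : ℝ)) hl
  simp only [Real.norm_eq_abs, sq_abs] at h1
  simp only [norm_gradient] at h2
  simp only [RCLike.inner_apply, conj_trivial, mul_one] at h3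
  -- Both sides are `L²`-continuous, so it suffices to treat the approximating test functions, which
  -- are smooth and Lipschitz.
  refine le_of_tendsto_of_tendsto (h1.sub ((h3.pow 2).const_mul _)) (h2.const_mul _)
    (Eventually.of_forall fun n => ?_)
  obtain ⟨w, hw, hws⟩ := T.exists_vertices hs
  obtain ⟨C, hC⟩ := (hφ n).1.lipschitzWith_of_hasCompactSupport (hφ n).2.1 (by simp)
  have hmem : ∀ i, w i ∈ s := fun i => by
    have : w i ∈ (s : Set (Space d)) := hws ▸ Set.mem_range_self i
    exact this
  have key := poincare_simplex hd hd3 hw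
    (fun i j => T.dist_le_meshSize hs (hmem i) (hmem j)) ((hφ n).1.of_le (by simp)) hC
  rwa [hws] at key

end GrossPitaevskii

/-! ### Weak divergences and the Raviart-Thomas space. -/

namespace GrossPitaevskii

variable {d : ℕ} {Ω : Set (Space d)}

lemma inner_gradient_eq_sum (φ : Space d → ℝ) (x z : Space d) :
    inner ℝ z (gradient φ x) = ∑ i, z i * fderiv ℝ φ x (EuclideanSpace.single i 1) := by
  rw [real_inner_comm, inner_gradient_left]
  conv_lhs => rw [← (EuclideanSpace.basisFun (Fin d) ℝ).sum_repr z]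
  simp [map_sum]

/-- Integration by parts for affine vector fields of Raviart-Thomas type. -/
lemma integral_inner_affine_gradient {φ : Space d → ℝ} (hφ : ContDiff ℝ ∞ φ)
    (hc : HasCompactSupport φ) (a : Space d) (b : ℝ) :
    ∫ x, inner ℝ (a + b • x) (gradient φ x) = -(b * d * ∫ x, φ x) := by
  have hφc := hφ.continuous
  have hφd := hφ.continuous_fderiv (by simp)
  have hdc := hc.fderiv (𝕜 := ℝ)
  have hf : ∀ i x, HasFDerivAt (fun x : Space d => a i + b * x i)
      (b • (EuclideanSpace.proj i : Space d →L[ℝ] ℝ)) x := fun i x =>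
    (((EuclideanSpace.proj i : Space d →L[ℝ] ℝ).hasFDerivAt).const_mul b).const_add (a i)
  have hi1 : ∀ i, Integrable fun x : Space d =>
      (a i + b * x i) * fderiv ℝ φ x (EuclideanSpace.single i 1) := by
    intro i
    refine Continuous.integrable_of_hasCompactSupport (by fun_prop) ?_
    exact (hdc.comp_left (g := fun L : Space d →L[ℝ] ℝ => L (EuclideanSpace.single i 1))
      (by simp)).mul_left
  have hi2 : Integrable φ := hφc.integrable_of_hasCompactSupport hc
  have h1 : ∀ i, ∫ x : Space d, (a i + b * x i) * fderiv ℝ φ x (EuclideanSpace.single i 1) =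
      -(b * ∫ x, φ x) := by
    intro i
    have h2 : ∀ x : Space d, fderiv ℝ (fun x : Space d => a i + b * x i) x
        (EuclideanSpace.single i 1) = b := fun x => by rw [(hf i x).fderiv]; simp
    rw [integral_mul_fderiv_eq_neg_fderiv_mul_of_integrable _ (hi1 i)
      (Continuous.integrable_of_hasCompactSupport (by fun_prop) hc.mul_left)
      (fun x _ => (hf i x).differentiableAt) (fun x _ => hφ.differentiable (by simp) x)]
    · simp only [h2, integral_const_mul]
    · simp only [h2]; exact hi2.const_mul b
  have h3 : ∀ x : Space d, inner ℝ (a + b • x) (gradient φ x) =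
      ∑ i, (a i + b * x i) * fderiv ℝ φ x (EuclideanSpace.single i 1) := fun x => by
    rw [inner_gradient_eq_sum]; simp
  simp only [h3]
  rw [integral_finsetSum _ fun i _ => hi1 i]
  simp only [h1, Finset.sum_const, Finset.card_univ, Fintype.card_fin, nsmul_eq_mul]
  ring

namespace IsWeakDivergence

variable {τ τ' g : Space d → Space d} {δ δ' v : Space d → ℝ}

lemma add (hτ : IsWeakDivergence Ω τ δ) (hτ' : IsWeakDivergence Ω τ' δ') :
    IsWeakDivergence Ω (τ + τ') (δ + δ') := by
  refine ⟨hτ.1.add hτ'.1, hτ.2.1.add hτ'.2.1, fun φ hφ => ?_⟩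
  have h1 := integrable_inner_of_memLp hτ.1 (hφ.memLp_gradient Ω)
  have h2 := integrable_inner_of_memLp hτ'.1 (hφ.memLp_gradient Ω)
  have h3 : Integrable (fun x => δ x * φ x) (volume.restrict Ω) :=
    hτ.2.1.integrable_mul (hφ.memLp Ω)
  have h4 : Integrable (fun x => δ' x * φ x) (volume.restrict Ω) :=
    hτ'.2.1.integrable_mul (hφ.memLp Ω)
  simp only [Pi.add_apply, inner_add_left, add_mul]
  rw [integral_add h1 h2, hτ.2.2 φ hφ, hτ'.2.2 φ hφ, integral_add h3 h4]
  ring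

lemma const_smul (c : ℝ) (hτ : IsWeakDivergence Ω τ δ) : IsWeakDivergence Ω (c • τ) (c • δ) := by
  refine ⟨hτ.1.const_smul c, hτ.2.1.const_smul c, fun φ hφ => ?_⟩
  simp only [Pi.smul_apply, real_inner_smul_left, smul_eq_mul, mul_assoc]
  rw [integral_const_mul, integral_const_mul, hτ.2.2 φ hφ]
  ring

lemma zero : IsWeakDivergence Ω (0 : Space d → Space d) 0 :=
  ⟨MemLp.zero, MemLp.zero, fun φ _ => by simp⟩

lemma congr (hτ : IsWeakDivergence Ω τ δ) (h : τ =ᵐ[volume.restrict Ω] τ') :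
    IsWeakDivergence Ω τ' δ := by
  refine ⟨(memLp_congr_ae h).1 hτ.1, hτ.2.1, fun φ hφ => ?_⟩
  rw [← hτ.2.2 φ hφ]
  refine integral_congr_ae ?_
  filter_upwards [h] with x hx
  rw [hx]

/-- The integration by parts formula for functions in `H¹₀(Ω)`. -/
lemma integral_inner_eq (hτ : IsWeakDivergence Ω τ δ) (hv : MemH10 Ω v g) :
    ∫ x in Ω, inner ℝ (τ x) (g x) = -∫ x in Ω, δ x * v x := by
  obtain ⟨⟨hv2, hg2, -⟩, φ, hφ, hlim, hlim'⟩ := hv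
  have h1 := tendsto_integral_inner (fun n => (hφ n).memLp_gradient Ω) hg2 hτ.1 hlim'
  have h2 := tendsto_integral_inner (fun n => (hφ n).memLp Ω) hv2 hτ.2.1 hlim
  simp only [RCLike.inner_apply, conj_trivial, mul_comm _ (δ _)] at h2
  refine tendsto_nhds_unique h1 (h2.neg.congr fun n => ?_)
  exact (hτ.2.2 _ (hφ n)).symm

end IsWeakDivergence

namespace SimplicialMesh

/-- The divergence of a Raviart-Thomas function is piecewise constant. -/
lemma IsRaviartThomas.exists_divergence_eq (hΩ : IsOpen Ω) (hc : Convex ℝ Ω) (hne : Ω.Nonempty)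
    {T : SimplicialMesh Ω} {τ : Space d → Space d} {δ : Space d → ℝ}
    (hτ : T.IsRaviartThomas τ δ) {s : Finset (Space d)} (hs : s ∈ T.elements) :
    ∃ c : ℝ, ∀ᵐ x ∂(volume.restrict (simplex s)), δ x = c := by
  obtain ⟨a, b, hab⟩ := hτ.2 s hs
  rw [T.ae_restrict_imp_iff hΩ hc hs] at hab
  refine ⟨b * d, ?_⟩
  have hsub := T.interior_simplex_subset hΩ hc hne hs
  rw [← Measure.restrict_congr_set (interior_simplex_ae_eq s)] at hab ⊢
  rw [ae_restrict_iff' isOpen_interior.measurableSet]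
  have hδ : IntegrableOn δ (interior (simplex s)) := by
    have : IsFiniteMeasure (volume.restrict (interior (simplex s))) := by
      rw [Measure.restrict_congr_set (interior_simplex_ae_eq s)]; infer_instance
    exact (hτ.1.2.1.mono_measure (Measure.restrict_mono hsub le_rfl)).integrable (by norm_num)
  have hδ' : IntegrableOn (fun x => δ x - b * d) (interior (simplex s)) :=
    hδ.sub (integrableOn_const ((measure_mono interior_subset).trans_lt
      (isCompact_simplex s).measure_lt_top).ne)
  have key := isOpen_interior.ae_eq_zero_of_integral_contDiff_smul_eq_zero (μ := volume)
    hδ'.locallyIntegrableOn fun φ hφ hφc hφs => ?_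
  · filter_upwards [key] with x hx hxs using sub_eq_zero.1 (hx hxs)
  · have htest : IsTestFunction Ω φ := ⟨hφ, hφc, hφs.trans hsub⟩
    have hz : ∀ x, x ∉ interior (simplex s) → φ x = 0 := fun x hx =>
      image_eq_zero_of_notMem_tsupport fun h => hx (hφs h)
    have hzg : ∀ x, x ∉ interior (simplex s) → gradient φ x = 0 := fun x hx => by
      have : fderiv ℝ φ x = 0 :=
        image_eq_zero_of_notMem_tsupport fun h => hx (hφs (tsupport_fderiv_subset ℝ h))
      rw [gradient, this, map_zero]
    have h1 : ∫ x in Ω, inner ℝ (τ x) (gradient φ x) = -(b * d * ∫ x, φ x) := by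
      rw [← integral_inner_affine_gradient hφ hφc a b,
        setIntegral_eq_of_subset_of_forall_sdiff_eq_zero hΩ.measurableSet hsub
          (fun x hx => by rw [hzg x hx.2, inner_zero_right]),
        ← setIntegral_eq_integral_of_forall_compl_eq_zero (s := interior (simplex s))
          (f := fun x => inner ℝ (a + b • x) (gradient φ x)) (fun x hx => by rw [hzg x hx, inner_zero_right])]
      refine integral_congr_ae ?_
      filter_upwards [hab] with x hx
      rw [hx]
    have h2 : ∫ x in Ω, δ x * φ x = ∫ x in interior (simplex s), δ x * φ x :=
      setIntegral_eq_of_subset_of_forall_sdiff_eq_zero hΩ.measurableSet hsub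
        (fun x hx => by rw [hz x hx.2, mul_zero])
    have h3 := hτ.1.2.2 φ htest
    rw [h1, h2] at h3
    rw [← setIntegral_eq_integral_of_forall_compl_eq_zero (s := interior (simplex s))
      (f := φ) hz] at h3
    rw [← setIntegral_eq_integral_of_forall_compl_eq_zero (s := interior (simplex s))
      (f := fun x => φ x • (δ x - b * d)) (fun x hx => by rw [hz x hx, zero_smul])]
    have hφi : IntegrableOn φ (interior (simplex s)) :=
      (hφ.continuous.integrable_of_hasCompactSupport hφc).integrableOn
    have hδφ : IntegrableOn (fun x => δ x * φ x) (interior (simplex s)) := by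
      refine MemLp.integrable_mul (p := 2) (q := 2) ?_ ?_
      · exact hτ.1.2.1.mono_measure (Measure.restrict_mono hsub le_rfl)
      · exact htest.memLp _
    simp only [smul_eq_mul, mul_sub]
    have h4 : ∀ x, φ x * δ x = δ x * φ x := fun x => mul_comm _ _
    simp only [h4]
    rw [integral_sub hδφ (hφi.mul_const _), integral_mul_const]
    linarith

namespace IsRaviartThomas

variable {T : SimplicialMesh Ω} {τ τ' : Space d → Space d} {δ δ' : Space d → ℝ}

lemma add (h : T.IsRaviartThomas τ δ) (h' : T.IsRaviartThomas τ' δ') :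
    T.IsRaviartThomas (τ + τ') (δ + δ') := by
  refine ⟨h.1.add h'.1, fun s hs => ?_⟩
  obtain ⟨a, b, hab⟩ := h.2 s hs
  obtain ⟨a', b', hab'⟩ := h'.2 s hs
  refine ⟨a + a', b + b', ?_⟩
  filter_upwards [hab, hab'] with x hx hx' hxs
  rw [Pi.add_apply, hx hxs, hx' hxs, add_smul]
  abel

lemma const_smul (c : ℝ) (h : T.IsRaviartThomas τ δ) : T.IsRaviartThomas (c • τ) (c • δ) := by
  refine ⟨h.1.const_smul c, fun s hs => ?_⟩
  obtain ⟨a, b, hab⟩ := h.2 s hs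
  refine ⟨c • a, c * b, ?_⟩
  filter_upwards [hab] with x hx hxs
  rw [Pi.smul_apply, hx hxs, smul_add, mul_smul]

lemma zero : T.IsRaviartThomas (0 : Space d → Space d) 0 :=
  ⟨IsWeakDivergence.zero, fun s _ => ⟨0, 0, Eventually.of_forall fun x _ => by simp⟩⟩

lemma congr (h : T.IsRaviartThomas τ δ) (hττ' : τ =ᵐ[volume.restrict Ω] τ') :
    T.IsRaviartThomas τ' δ := by
  refine ⟨h.1.congr hττ', fun s hs => ?_⟩
  obtain ⟨a, b, hab⟩ := h.2 s hs
  refine ⟨a, b, ?_⟩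
  filter_upwards [hab, hττ'] with x hx hx' hxs
  rw [← hx', hx hxs]

end IsRaviartThomas

/-- The piecewise affine vector field with given coefficients. -/
noncomputable def affineField (T : SimplicialMesh Ω) :
    (T.elements → Space d × ℝ) →ₗ[ℝ] (Space d → Space d) where
  toFun c x := ∑ s : T.elements, (simplex s.1).indicator (fun x => (c s).1 + (c s).2 • x) x
  map_add' c c' := by
    funext x
    simp only [Pi.add_apply, ← Finset.sum_add_distrib]
    refine Finset.sum_congr rfl fun s _ => ?_
    by_cases hx : x ∈ simplex s.1
    · simp only [Set.indicator_of_mem hx, Prod.fst_add, Prod.snd_add, add_smul]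
      abel
    · simp only [Set.indicator_of_notMem hx, add_zero]
  map_smul' r c := by
    funext x
    simp only [Pi.smul_apply, Finset.smul_sum, RingHom.id_apply]
    refine Finset.sum_congr rfl fun s _ => ?_
    by_cases hx : x ∈ simplex s.1
    · simp only [Set.indicator_of_mem hx, Prod.smul_fst, Prod.smul_snd, smul_add, smul_assoc]
    · simp only [Set.indicator_of_notMem hx, smul_zero]

lemma affineField_ae_eq (T : SimplicialMesh Ω) (c : T.elements → Space d × ℝ)
    (s : T.elements) : ∀ᵐ x ∂(volume.restrict (simplex s.1)),
      T.affineField c x = (c s).1 + (c s).2 • x := by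
  classical
  have h := T.piecewise_ae_eq
    (fun t x => if ht : t ∈ T.elements then (c ⟨t, ht⟩).1 + (c ⟨t, ht⟩).2 • x else 0) s.2
  filter_upwards [h] with x hx
  simp only [s.2, dif_pos] at hx
  rw [← hx, piecewise, ← Finset.sum_coe_sort]
  refine Finset.sum_congr rfl fun t _ => ?_
  simp [t.2]

lemma memLp_affineField (T : SimplicialMesh Ω) (c : T.elements → Space d × ℝ) :
    MemLp (T.affineField c) 2 (volume.restrict Ω) := by
  refine MemLp.restrict Ω ?_
  have : T.affineField c = ∑ s : T.elements,
      (simplex s.1).indicator (fun x => (c s).1 + (c s).2 • x) := by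
    funext x; simp [affineField]
  rw [this]
  refine memLp_finsetSum' _ fun s _ => ?_
  rw [memLp_indicator_iff_restrict (measurableSet_simplex s.1)]
  have hcont : Continuous fun x : Space d => (c s).1 + (c s).2 • x := by fun_prop
  obtain ⟨C, hC⟩ := (isCompact_simplex s.1).exists_bound_of_continuousOn hcont.continuousOn
  exact MemLp.of_bound hcont.aestronglyMeasurable C
    ((ae_restrict_mem (measurableSet_simplex s.1)).mono fun x hx => hC x hx)

lemma IsRaviartThomas.exists_ae_eq_affineField (hΩ : IsOpen Ω) (hc : Convex ℝ Ω)
    {T : SimplicialMesh Ω} {τ : Space d → Space d} {δ : Space d → ℝ}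
    (h : T.IsRaviartThomas τ δ) : ∃ c, τ =ᵐ[volume.restrict Ω] T.affineField c := by
  choose a b hab using fun s : T.elements => h.2 s.1 s.2
  refine ⟨fun s => (a s, b s), (T.ae_restrict_iff_forall hΩ hc).2 fun s hs => ?_⟩
  filter_upwards [(T.ae_restrict_imp_iff hΩ hc hs).1 (hab ⟨s, hs⟩),
    T.affineField_ae_eq (fun s => (a s, b s)) ⟨s, hs⟩] with x hx hx'
  rw [hx, hx']

/-- The `L²` projection onto the Raviart-Thomas space. -/
theorem exists_raviartThomas_projection (T : SimplicialMesh Ω) (hΩ : IsOpen Ω)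
    (hc : Convex ℝ Ω) {g : Space d → Space d} (hg : MemLp g 2 (volume.restrict Ω)) :
    ∃ σ δ, T.IsRaviartThomas σ δ ∧ ∀ τ δ', T.IsRaviartThomas τ δ' →
      ∫ x in Ω, inner ℝ (σ x) (τ x) = ∫ x in Ω, inner ℝ (g x) (τ x) := by
  let Φ : (T.elements → Space d × ℝ) →ₗ[ℝ] Lp (Space d) 2 (volume.restrict Ω) :=
    { toFun := fun c => (T.memLp_affineField c).toLp _
      map_add' := fun c c' => by
        rw [← MemLp.toLp_add]; simp only [map_add]
      map_smul' := fun r c => by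
        simp only [RingHom.id_apply]
        rw [← MemLp.toLp_const_smul]; simp only [map_smul] }
  -- Raviart-Thomas fields are described by finitely many coefficients, so their image in `L²` is
  -- finite dimensional and has an orthogonal projection.
  let W : Submodule ℝ (T.elements → Space d × ℝ) :=
    { carrier := {c | ∃ δ, T.IsRaviartThomas (T.affineField c) δ}
      zero_mem' := ⟨0, by rw [map_zero]; exact .zero⟩
      add_mem' := by
        rintro c c' ⟨δ, h⟩ ⟨δ', h'⟩
        exact ⟨δ + δ', by rw [map_add]; exact h.add h'⟩
      smul_mem' := by
        rintro r c ⟨δ, h⟩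
        exact ⟨r • δ, by rw [map_smul]; exact h.const_smul r⟩ }
  have : FiniteDimensional ℝ (W.map Φ) := inferInstance
  obtain ⟨c, ⟨δ, hcδ⟩, hcp⟩ := ((W.map Φ).starProjection_apply_mem (hg.toLp g))
  refine ⟨T.affineField c, δ, hcδ, fun τ δ' hτ => ?_⟩
  obtain ⟨c', hc'⟩ := hτ.exists_ae_eq_affineField hΩ hc
  have h1 := (W.map Φ).starProjection_inner_eq_zero (hg.toLp g) (Φ c')
    ⟨c', ⟨δ', hτ.congr hc'⟩, rfl⟩
  rw [← hcp, inner_sub_left, sub_eq_zero] at h1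
  change inner ℝ (hg.toLp g) ((T.memLp_affineField c').toLp _) =
    inner ℝ ((T.memLp_affineField c).toLp _) ((T.memLp_affineField c').toLp _) at h1
  rw [inner_toLp_toLp, inner_toLp_toLp] at h1
  have h2 : ∀ f : Space d → Space d, ∫ x in Ω, inner ℝ (f x) (τ x) =
      ∫ x in Ω, inner ℝ (f x) (T.affineField c' x) := fun f => by
    refine integral_congr_ae ?_
    filter_upwards [hc'] with x hx
    rw [hx]
  rw [h2, h2, h1]

end SimplicialMesh

end GrossPitaevskii

/-! ### Norm identities and Cauchy-Schwarz on a finite measure space. -/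

section L2Norm

variable {α : Type*} [MeasurableSpace α] {ν : Measure α} {E : Type*} [NormedAddCommGroup E]
  [InnerProductSpace ℝ E]

lemma integral_norm_sq_eq_eLpNorm_sq {f : α → E} (hf : MemLp f 2 ν) :
    ∫ x, ‖f x‖ ^ 2 ∂ν = (eLpNorm f 2 ν).toReal ^ 2 := by
  simp only [← real_inner_self_eq_norm_sq]
  rw [← inner_toLp_toLp hf hf, real_inner_self_eq_norm_sq, Lp.norm_toLp]

/-- Expand `∫ (f - c)² ≥ 0` at the mean value `c = I / m`; a null measure is treated apart. -/
lemma sq_integral_le_measureReal_mul [IsFiniteMeasure ν] {f : α → ℝ} (hf : Integrable f ν)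
    (hf2 : Integrable (fun x => f x ^ 2) ν) :
    (∫ x, f x ∂ν) ^ 2 ≤ ν.real Set.univ * ∫ x, f x ^ 2 ∂ν := by
  set m := ν.real Set.univ
  set I := ∫ x, f x ∂ν
  have h0 : ∀ c : ℝ, 0 ≤ (∫ x, f x ^ 2 ∂ν) - 2 * c * I + c ^ 2 * m := by
    intro c
    have h1 : ∫ x, (f x - c) ^ 2 ∂ν = (∫ x, f x ^ 2 ∂ν) - 2 * c * I + c ^ 2 * m := by
      have h2 : ∀ x, (f x - c) ^ 2 = f x ^ 2 - 2 * c * f x + c ^ 2 := fun x => by ring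
      simp only [h2]
      have h3 : Integrable (fun x => f x ^ 2 - 2 * c * f x) ν := hf2.sub (hf.const_mul _)
      rw [integral_add h3 (integrable_const _), integral_sub hf2 (hf.const_mul _), integral_const_mul, integral_const, smul_eq_mul]
      ring
    rw [← h1]
    exact integral_nonneg fun x => sq_nonneg _
  have hm : 0 ≤ m := measureReal_nonneg
  rcases hm.eq_or_lt with hm | hm
  · have hI : I = 0 := by
      have : ν = 0 := by
        rw [← Measure.measure_univ_eq_zero]
        exact (measureReal_eq_zero_iff).1 hm.symm
      simp only [I, this, integral_zero_measure]
    rw [hI, ← hm]; simp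
  · have h1 := h0 (I / m)
    have h2 : (∫ x, f x ^ 2 ∂ν) - 2 * (I / m) * I + (I / m) ^ 2 * m =
        (∫ x, f x ^ 2 ∂ν) - I ^ 2 / m := by field_simp; ring
    rw [h2, sub_nonneg, div_le_iff₀ hm] at h1
    linarith

end L2Norm

/-! ### Piecewise means, discrete gradients and the energy comparison. -/

namespace GrossPitaevskii

variable {d : ℕ} {Ω : Set (Space d)}

namespace SimplicialMesh

lemma integral_eq_sum (T : SimplicialMesh Ω) (hΩ : IsOpen Ω) (hc : Convex ℝ Ω) {f : Space d → ℝ}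
    (hf : ∀ s ∈ T.elements, IntegrableOn f (simplex s)) :
    ∫ x in Ω, f x = ∑ s ∈ T.elements, ∫ x in simplex s, f x := by
  rw [T.restrict_eq_sum hΩ hc, integral_finsetSum_measure hf]

lemma integrableOn_iff (T : SimplicialMesh Ω) (hΩ : IsOpen Ω) (hc : Convex ℝ Ω)
    {f : Space d → ℝ} :
    IntegrableOn f Ω ↔ ∀ s ∈ T.elements, IntegrableOn f (simplex s) := by
  rw [IntegrableOn, T.restrict_eq_sum hΩ hc, integrable_finsetSum_measure]
  rfl

/-- The mean value of `v` on the element `s`. -/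
noncomputable def mean (v : Space d → ℝ) (s : Finset (Space d)) : ℝ :=
  (volume.real (simplex s))⁻¹ * ∫ x in simplex s, v x

/-- The piecewise constant function with the mean values of `v`. -/
noncomputable def meanFun (T : SimplicialMesh Ω) (v : Space d → ℝ) : Space d → ℝ :=
  T.piecewise fun s _ => mean v s

lemma meanFun_ae_eq (T : SimplicialMesh Ω) (v : Space d → ℝ) {s : Finset (Space d)}
    (hs : s ∈ T.elements) : ∀ᵐ x ∂(volume.restrict (simplex s)), T.meanFun v x = mean v s :=
  T.piecewise_ae_eq _ hs

lemma isPiecewiseConstant_iff (T : SimplicialMesh Ω) (hΩ : IsOpen Ω) (hc : Convex ℝ Ω)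
    {v : Space d → ℝ} : T.IsPiecewiseConstant v ↔
      ∀ s ∈ T.elements, ∃ c : ℝ, ∀ᵐ x ∂(volume.restrict (simplex s)), v x = c :=
  forall₂_congr fun _ hs => exists_congr fun _ => T.ae_restrict_imp_iff hΩ hc hs

lemma mean_mul_volume (T : SimplicialMesh Ω) (v : Space d → ℝ) {s : Finset (Space d)}
    (hs : s ∈ T.elements) :
    mean v s * volume.real (simplex s) = ∫ x in simplex s, v x := by
  have := (T.volume_real_simplex_pos hs).ne'
  rw [mean]; field_simp

lemma memLp_meanFun (T : SimplicialMesh Ω) (v : Space d → ℝ) :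
    MemLp (T.meanFun v) 2 (volume.restrict Ω) := by
  unfold meanFun piecewise
  refine memLp_finsetSum _ fun s _ => MemLp.restrict Ω ?_
  rw [memLp_indicator_iff_restrict (measurableSet_simplex s)]
  exact memLp_const _

/-- A function of a real variable applied to the mean values. -/
lemma integral_mul_comp_meanFun (T : SimplicialMesh Ω) (hΩ : IsOpen Ω) (hc : Convex ℝ Ω)
    {V : Space d → ℝ} {V₀ : Finset (Space d) → ℝ}
    (hV : ∀ s ∈ T.elements, ∀ᵐ x ∂(volume.restrict (simplex s)), V x = V₀ s)
    (v : Space d → ℝ) (F : ℝ → ℝ) :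
    IntegrableOn (fun x => V x * F (T.meanFun v x)) Ω ∧
      ∫ x in Ω, V x * F (T.meanFun v x) =
        ∑ s ∈ T.elements, V₀ s * F (mean v s) * volume.real (simplex s) := by
  have h1 : ∀ s ∈ T.elements, (fun x => V x * F (T.meanFun v x)) =ᵐ[volume.restrict (simplex s)]
      fun _ => V₀ s * F (mean v s) := fun s hs => by
    filter_upwards [hV s hs, T.meanFun_ae_eq v hs] with x hx hx'
    rw [hx, hx']
  have h2 : ∀ s ∈ T.elements, IntegrableOn (fun x => V x * F (T.meanFun v x)) (simplex s) :=
    fun s hs => (integrable_congr (h1 s hs)).2 (integrable_const _)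
  refine ⟨(T.integrableOn_iff hΩ hc).2 h2, ?_⟩
  rw [T.integral_eq_sum hΩ hc h2]
  refine Finset.sum_congr rfl fun s hs => ?_
  rw [integral_congr_ae (h1 s hs), setIntegral_const, smul_eq_mul]
  ring

/-- The projection of the gradient is the discrete gradient of the projection. -/
lemma exists_isDiscreteGradient_meanFun (T : SimplicialMesh Ω) (hΩ : IsOpen Ω) (hc : Convex ℝ Ω)
    (hne : Ω.Nonempty) {v : Space d → ℝ} {g : Space d → Space d} (hv : MemH10 Ω v g) :
    ∃ σ, T.IsDiscreteGradient (T.meanFun v) σ ∧ MemLp σ 2 (volume.restrict Ω) ∧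
      ∫ x in Ω, ‖σ x‖ ^ 2 ≤ ∫ x in Ω, ‖g x‖ ^ 2 := by
  obtain ⟨σ, δ, hσ, hproj⟩ := T.exists_raviartThomas_projection hΩ hc hv.1.2.1
  have hg2 := hv.1.2.1
  have hσ2 := hσ.1.1
  refine ⟨σ, ⟨⟨δ, hσ⟩, fun τ δ' hτ => ?_⟩, hσ2, ?_⟩
  -- The chain is `(σ, τ) = (g, τ) = -(div τ, v) = -(div τ, Πv)`, the last step because `div τ` is
  -- constant on each element.
  · rw [hproj τ δ' hτ]
    simp only [real_inner_comm (τ _) (g _)]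
    rw [hτ.1.integral_inner_eq hv]
    have h1 : ∀ s ∈ T.elements, ∃ c : ℝ, ∀ᵐ x ∂(volume.restrict (simplex s)), δ' x = c :=
      fun s hs => hτ.exists_divergence_eq hΩ hc hne hs
    choose! c hcs using h1
    have h2 := (T.integral_mul_comp_meanFun hΩ hc hcs v id).2
    have h3 : IntegrableOn (fun x => δ' x * v x) Ω := hτ.1.2.1.integrable_mul hv.1.1
    simp only [id] at h2
    rw [h2, T.integral_eq_sum hΩ hc ((T.integrableOn_iff hΩ hc).1 h3), neg_add_eq_zero]
    refine Finset.sum_congr rfl fun s hs => ?_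
    rw [mul_assoc, T.mean_mul_volume v hs, ← integral_const_mul]
    refine integral_congr_ae ?_
    filter_upwards [hcs s hs] with x hx
    rw [hx]
  -- Testing the projection with `σ` itself gives `‖σ‖² = (g, σ)`, and Young's inequality finishes.
  · have h1 := hproj σ δ hσ
    have hG : IntegrableOn (fun x => ‖g x‖ ^ 2) Ω := hg2.norm.integrable_sq
    have hS : IntegrableOn (fun x => ‖σ x‖ ^ 2) Ω := hσ2.norm.integrable_sq
    have hI := integrable_inner_of_memLp hg2 hσ2
    simp only [real_inner_self_eq_norm_sq] at h1
    have h2 : ∫ x in Ω, inner ℝ (g x) (σ x) ≤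
        ∫ x in Ω, (1 / 2 * ‖g x‖ ^ 2 + 1 / 2 * ‖σ x‖ ^ 2) := by
      refine integral_mono hI ((hG.const_mul _).add (hS.const_mul _)) fun x => ?_
      have h3 := real_inner_le_norm (g x) (σ x)
      have h4 := sq_nonneg (‖g x‖ - ‖σ x‖)
      change inner ℝ (g x) (σ x) ≤ 1 / 2 * ‖g x‖ ^ 2 + 1 / 2 * ‖σ x‖ ^ 2
      nlinarith
    rw [integral_add (hG.const_mul _) (hS.const_mul _), integral_const_mul,
      integral_const_mul] at h2
    linarith

lemma IsDiscreteGradient.const_smul {T : SimplicialMesh Ω} {v : Space d → ℝ}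
    {σ : Space d → Space d} (r : ℝ) (h : T.IsDiscreteGradient v σ) :
    T.IsDiscreteGradient (r • v) (r • σ) := by
  obtain ⟨⟨δ, hδ⟩, h2⟩ := h
  refine ⟨⟨r • δ, hδ.const_smul r⟩, fun τ δ' hτ => ?_⟩
  have h3 := h2 τ δ' hτ
  simp only [Pi.smul_apply, real_inner_smul_left, smul_eq_mul, mul_left_comm _ r]
  rw [integral_const_mul, integral_const_mul, ← mul_add, h3, mul_zero]

end SimplicialMesh

/-- All terms of the density are nonnegative, so each is dominated by a multiple of it. Finite
energy and `κ > 0` thus yield `v ∈ L⁴` without a Sobolev embedding. -/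
lemma integrable_density_terms {V v : Space d → ℝ} {g : Space d → Space d} {κ : ℝ} (hκ : 0 < κ)
    (hV : AEStronglyMeasurable V (volume.restrict Ω)) (hV0 : ∀ᵐ x ∂(volume.restrict Ω), 0 ≤ V x)
    (hv : MemLp v 2 (volume.restrict Ω)) (hg : MemLp g 2 (volume.restrict Ω))
    (he : energy Ω V κ v g ≠ ⊤) :
    IntegrableOn (fun x => V x * v x ^ 2) Ω ∧ IntegrableOn (fun x => v x ^ 4) Ω ∧
      (energy Ω V κ v g).toReal = 1 / 2 * (∫ x in Ω, ‖g x‖ ^ 2) +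
        1 / 2 * (∫ x in Ω, V x * v x ^ 2) + κ / 4 * ∫ x in Ω, v x ^ 4 := by
  have hvm := hv.1
  have hgm := hg.1
  have hG : IntegrableOn (fun x => ‖g x‖ ^ 2) Ω := hg.norm.integrable_sq
  set D : Space d → ℝ := fun x => 1 / 2 * ‖g x‖ ^ 2 + 1 / 2 * (V x * v x ^ 2) + κ / 4 * v x ^ 4
  have hVm : AEStronglyMeasurable (fun x => V x * v x ^ 2) (volume.restrict Ω) :=
    hV.mul (hvm.pow 2)
  have hDm : AEStronglyMeasurable D (volume.restrict Ω) :=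
    ((hG.1.const_mul _).add (hVm.const_mul _)).add ((hvm.pow 4).const_mul _)
  have hD0 : 0 ≤ᵐ[volume.restrict Ω] D := by
    filter_upwards [hV0] with x hx
    change 0 ≤ 1 / 2 * ‖g x‖ ^ 2 + 1 / 2 * (V x * v x ^ 2) + κ / 4 * v x ^ 4
    positivity
  have hD : IntegrableOn D Ω :=
    ⟨hDm, (hasFiniteIntegral_iff_ofReal hD0).2 (lt_top_iff_ne_top.2 he)⟩
  have hV2 : IntegrableOn (fun x => V x * v x ^ 2) Ω := by
    refine (hD.const_mul 2).mono' hVm ?_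
    filter_upwards [hV0] with x hx
    rw [Real.norm_of_nonneg (by positivity)]
    have : 0 ≤ κ / 4 * v x ^ 4 := by positivity
    simp only [D]
    nlinarith [sq_nonneg ‖g x‖]
  have hv4 : IntegrableOn (fun x => v x ^ 4) Ω := by
    refine (hD.const_mul (4 / κ)).mono' (hvm.pow 4) ?_
    filter_upwards [hV0] with x hx
    rw [Real.norm_of_nonneg (by positivity)]
    have h1 : 0 ≤ 4 / κ * (1 / 2 * ‖g x‖ ^ 2 + 1 / 2 * (V x * v x ^ 2)) := by positivity
    have h2 : 4 / κ * (κ / 4 * v x ^ 4) = v x ^ 4 := by field_simp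
    simp only [D]
    rw [mul_add, h2]
    linarith
  refine ⟨hV2, hv4, ?_⟩
  have h1 : (energy Ω V κ v g).toReal = ∫ x in Ω, D x := by
    rw [integral_eq_lintegral_of_nonneg_ae hD0 hDm]; rfl
  rw [h1]
  simp only [D]
  have hGV : IntegrableOn (fun x => 1 / 2 * ‖g x‖ ^ 2 + 1 / 2 * (V x * v x ^ 2)) Ω :=
    (hG.const_mul _).add (hV2.const_mul _)
  rw [integral_add hGV (hv4.const_mul _),
    integral_add (hG.const_mul _) (hV2.const_mul _), integral_const_mul, integral_const_mul,
    integral_const_mul]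

lemma energy_eq_ofReal {V v : Space d → ℝ} {g : Space d → Space d} {κ : ℝ} (hκ : 0 < κ)
    (hV0 : ∀ᵐ x ∂(volume.restrict Ω), 0 ≤ V x)
    (hg : MemLp g 2 (volume.restrict Ω))
    (hVv : IntegrableOn (fun x => V x * v x ^ 2) Ω) (hv4 : IntegrableOn (fun x => v x ^ 4) Ω) :
    energy Ω V κ v g = ENNReal.ofReal (1 / 2 * (∫ x in Ω, ‖g x‖ ^ 2) +
        1 / 2 * (∫ x in Ω, V x * v x ^ 2) + κ / 4 * ∫ x in Ω, v x ^ 4) := by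
  have hG : IntegrableOn (fun x => ‖g x‖ ^ 2) Ω := hg.norm.integrable_sq
  have hGV : IntegrableOn (fun x => 1 / 2 * ‖g x‖ ^ 2 + 1 / 2 * (V x * v x ^ 2)) Ω :=
    (hG.const_mul _).add (hVv.const_mul _)
  have hall : IntegrableOn
      (fun x => 1 / 2 * ‖g x‖ ^ 2 + 1 / 2 * (V x * v x ^ 2) + κ / 4 * v x ^ 4) Ω :=
    hGV.add (hv4.const_mul _)
  rw [energy, ← integral_const_mul, ← integral_const_mul, ← integral_const_mul,
    ← integral_add (hG.const_mul _) (hVv.const_mul _), ← integral_add hGV (hv4.const_mul _),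
    ofReal_integral_eq_lintegral_ofReal hall]
  filter_upwards [hV0] with x hx
  change 0 ≤ 1 / 2 * ‖g x‖ ^ 2 + 1 / 2 * (V x * v x ^ 2) + κ / 4 * v x ^ 4
  positivity

/-- The comparison of the discrete ground state energy with the energy of an admissible
function. -/
theorem discreteGroundStateEnergy_mul_le (hd : 1 ≤ d) (hd3 : d ≤ 3) (hΩ : IsOpen Ω)
    (hc : Convex ℝ Ω) (hne : Ω.Nonempty) (T : SimplicialMesh Ω) {V : Space d → ℝ}
    (hVm : AEStronglyMeasurable V (volume.restrict Ω))
    (hV0 : ∀ᵐ x ∂(volume.restrict Ω), 0 ≤ V x) (hVc : T.IsPiecewiseConstant V)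
    {κ : ℝ} (hκ : 0 < κ) {v : Space d → ℝ} {g : Space d → Space d} (hv : MemH10 Ω v g)
    (hnorm : eLpNorm v 2 (volume.restrict Ω) = 1) (he : energy Ω V κ v g ≠ ⊤) :
    T.discreteGroundStateEnergy V κ *
        (1 - 4 * T.meshSize ^ 2 * (Real.pi ^ 2)⁻¹ * (energy Ω V κ v g).toReal) ≤
      (energy Ω V κ v g).toReal := by
  obtain ⟨hVv, hv4, heq⟩ := integrable_density_terms hκ hVm hV0 hv.1.1 hv.1.2.1 he
  obtain ⟨σ, hσ, hσ2, hσg⟩ := T.exists_isDiscreteGradient_meanFun hΩ hc hne hv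
  have hv2 : IntegrableOn (fun x => v x ^ 2) Ω := hv.1.1.integrable_sq
  have hg2 : IntegrableOn (fun x => ‖g x‖ ^ 2) Ω := hv.1.2.1.norm.integrable_sq
  set Eh := T.discreteGroundStateEnergy V κ
  have hEh : 0 ≤ Eh := ENNReal.toReal_nonneg
  set e := (energy Ω V κ v g).toReal
  set G := ∫ x in Ω, ‖g x‖ ^ 2
  set P := ∫ x in Ω, V x * v x ^ 2
  set Q := ∫ x in Ω, v x ^ 4
  have hG0 : 0 ≤ G := integral_nonneg fun x => sq_nonneg _
  have hP0 : 0 ≤ P := integral_nonneg_of_ae (by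
    filter_upwards [hV0] with x hx
    exact mul_nonneg hx (sq_nonneg _))
  have hQ0 : 0 ≤ Q := integral_nonneg fun x => by positivity
  have hone : ∫ x in Ω, v x ^ 2 = 1 := by
    have := integral_norm_sq_eq_eLpNorm_sq hv.1.1
    simpa [hnorm] using this
  rw [T.isPiecewiseConstant_iff hΩ hc] at hVc
  choose! V₀ hV₀ using hVc
  have hV₀0 : ∀ s ∈ T.elements, 0 ≤ V₀ s := by
    intro s hs
    have h1 := (T.ae_restrict_iff_forall hΩ hc).1 hV0 s hs
    -- Elements have positive volume, so two almost-everywhere statements hold at a common point.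
    have : (ae (volume.restrict (SimplicialMesh.simplex s))).NeBot := by
      rw [ae_neBot, Ne, Measure.restrict_eq_zero]
      intro h0
      have := T.volume_real_simplex_pos hs
      rw [measureReal_def, h0] at this
      simp at this
    obtain ⟨x, hx, hx'⟩ := (h1.and (hV₀ s hs)).exists
    rwa [hx'] at hx
  set A := fun s => SimplicialMesh.mean v s
  set m := fun s : Finset (Space d) => volume.real (SimplicialMesh.simplex s)
  have hm : ∀ s ∈ T.elements, 0 < m s := fun s hs => T.volume_real_simplex_pos hs
  have hmA : ∀ s ∈ T.elements, A s ^ 2 * m s =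
      (m s)⁻¹ * (∫ x in SimplicialMesh.simplex s, v x) ^ 2 := by
    intro s hs
    have h1 := (hm s hs).ne'
    rw [← T.mean_mul_volume v hs]
    change A s ^ 2 * m s = (m s)⁻¹ * (A s * m s) ^ 2
    field_simp
  set t := ∑ s ∈ T.elements, A s ^ 2 * m s
  have hI2 := (T.integrableOn_iff hΩ hc).1 hv2
  have hI4 := (T.integrableOn_iff hΩ hc).1 hv4
  have hIV := (T.integrableOn_iff hΩ hc).1 hVv
  have hIg := (T.integrableOn_iff hΩ hc).1 hg2
  have hI1 : ∀ s ∈ T.elements, IntegrableOn v (SimplicialMesh.simplex s) := fun s hs =>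
    (hv.1.1.mono_measure (T.restrict_simplex_le hΩ hc hs)).integrable (by norm_num)
  -- Jensen's inequality on the elements
  have hJ2 : ∀ s ∈ T.elements, A s ^ 2 * m s ≤ ∫ x in SimplicialMesh.simplex s, v x ^ 2 := by
    intro s hs
    have h1 := sq_integral_le_measureReal_mul (hI1 s hs) (hI2 s hs)
    rw [measureReal_restrict_apply_univ] at h1
    rw [hmA s hs, inv_mul_le_iff₀ (hm s hs)]
    exact h1
  have hJ4 : ∀ s ∈ T.elements, A s ^ 4 * m s ≤ ∫ x in SimplicialMesh.simplex s, v x ^ 4 := by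
    intro s hs
    have h4 : ∀ x, (v x ^ 2) ^ 2 = v x ^ 4 := fun x => by ring
    have h1 := sq_integral_le_measureReal_mul (hI2 s hs) (by simp only [h4]; exact hI4 s hs)
    rw [measureReal_restrict_apply_univ] at h1
    simp only [h4] at h1
    -- The quartic Jensen inequality is the quadratic one applied to `v` and then to `v²`.
    have h2 := pow_le_pow_left₀ (mul_nonneg (sq_nonneg _) (hm s hs).le) (hJ2 s hs) 2
    have h3 := h2.trans h1
    refine le_of_mul_le_mul_left ?_ (hm s hs)
    calc m s * (A s ^ 4 * m s) = (A s ^ 2 * m s) ^ 2 := by ring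
      _ ≤ _ := h3
  have ht1 : t ≤ 1 := by
    rw [← hone, T.integral_eq_sum hΩ hc hI2]
    exact Finset.sum_le_sum hJ2
  have ht0 : 0 ≤ t := Finset.sum_nonneg fun s hs => mul_nonneg (sq_nonneg _) (hm s hs).le
  -- the Poincaré inequality
  have htG : 1 - T.meshSize ^ 2 / Real.pi ^ 2 * G ≤ t := by
    have h1 : 1 - t ≤ T.meshSize ^ 2 / Real.pi ^ 2 * G := by
      rw [← hone, T.integral_eq_sum hΩ hc hI2, ← Finset.sum_sub_distrib]
      change _ ≤ _ * ∫ x in Ω, ‖g x‖ ^ 2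
      rw [T.integral_eq_sum hΩ hc hIg, Finset.mul_sum]
      refine Finset.sum_le_sum fun s hs => ?_
      rw [hmA s hs]
      exact hv.poincare hd hd3 hΩ hc T hs
    linarith
  have hPV : ∑ s ∈ T.elements, V₀ s * A s ^ 2 * m s ≤ P := by
    change _ ≤ ∫ x in Ω, V x * v x ^ 2
    rw [T.integral_eq_sum hΩ hc hIV]
    refine Finset.sum_le_sum fun s hs => ?_
    have h1 : ∫ x in SimplicialMesh.simplex s, V x * v x ^ 2 =
        V₀ s * ∫ x in SimplicialMesh.simplex s, v x ^ 2 := by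
      rw [← integral_const_mul]
      refine integral_congr_ae ?_
      filter_upwards [hV₀ s hs] with x hx
      rw [hx]
    rw [h1, mul_assoc]
    exact mul_le_mul_of_nonneg_left (hJ2 s hs) (hV₀0 s hs)
  have hQ4 : ∑ s ∈ T.elements, A s ^ 4 * m s ≤ Q := by
    change _ ≤ ∫ x in Ω, v x ^ 4
    rw [T.integral_eq_sum hΩ hc hI4]
    exact Finset.sum_le_sum hJ4
  have hEt : Eh * t ^ 2 ≤ e := by
    -- If `t = 0` the mean function cannot be normalised, but the claim is trivial.
    rcases ht0.eq_or_lt with h0 | htpos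
    · rw [← h0]
      have : 0 ≤ e := ENNReal.toReal_nonneg
      simpa using this
    set r := (Real.sqrt t)⁻¹
    have hr2 : r ^ 2 = t⁻¹ := by rw [inv_pow, Real.sq_sqrt ht0]
    have hr4 : r ^ 4 = (t ^ 2)⁻¹ := by
      rw [show r ^ 4 = (r ^ 2) ^ 2 by ring, hr2, inv_pow]
    -- Since `t ≤ 1`, the quadratic terms may also be charged the factor `r⁴ = t⁻²` of the quartic
    -- term.
    have hrle : r ^ 2 ≤ r ^ 4 := by
      rw [hr2, hr4]
      exact inv_anti₀ (by positivity) (by nlinarith)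
    have hVint := T.integral_mul_comp_meanFun hΩ hc hV₀ v fun z => (r * z) ^ 2
    have h4int := T.integral_mul_comp_meanFun hΩ hc (V := fun _ => 1) (V₀ := fun _ => 1)
      (fun s _ => Eventually.of_forall fun _ => rfl) v fun z => (r * z) ^ 4
    have h2int := T.integral_mul_comp_meanFun hΩ hc (V := fun _ => 1) (V₀ := fun _ => 1)
      (fun s _ => Eventually.of_forall fun _ => rfl) v fun z => (r * z) ^ 2
    simp only [one_mul] at h4int h2int
    have hσr : ∫ x in Ω, ‖(r • σ) x‖ ^ 2 = r ^ 2 * ∫ x in Ω, ‖σ x‖ ^ 2 := by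
      rw [← integral_const_mul]
      refine integral_congr_ae (Eventually.of_forall fun x => ?_)
      simp only [Pi.smul_apply, norm_smul, mul_pow, Real.norm_eq_abs, sq_abs]
    have hwLp : MemLp (r • T.meanFun v) 2 (volume.restrict Ω) := (T.memLp_meanFun v).const_smul r
    have hwn : eLpNorm (r • T.meanFun v) 2 (volume.restrict Ω) = 1 := by
      have h1 := integral_norm_sq_eq_eLpNorm_sq hwLp
      simp only [Pi.smul_apply, smul_eq_mul, Real.norm_eq_abs, sq_abs] at h1
      rw [h2int.2] at h1
      have h2 : ∑ s ∈ T.elements, (r * SimplicialMesh.mean v s) ^ 2 *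
          volume.real (SimplicialMesh.simplex s) = r ^ 2 * t := by
        simp only [t, Finset.mul_sum]
        exact Finset.sum_congr rfl fun s _ => by simp only [A, m]; ring
      rw [h2, hr2, inv_mul_cancel₀ htpos.ne'] at h1
      have h3 : (eLpNorm (r • T.meanFun v) 2 (volume.restrict Ω)).toReal = 1 := by
        have h4 := ENNReal.toReal_nonneg (a := eLpNorm (r • T.meanFun v) 2 (volume.restrict Ω))
        nlinarith
      rw [← ENNReal.ofReal_toReal hwLp.2.ne, h3, ENNReal.ofReal_one]
    have hwpc : T.IsPiecewiseConstant (r • T.meanFun v) := by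
      rw [T.isPiecewiseConstant_iff hΩ hc]
      intro s hs
      refine ⟨r * SimplicialMesh.mean v s, ?_⟩
      filter_upwards [T.meanFun_ae_eq v hs] with x hx
      rw [Pi.smul_apply, hx, smul_eq_mul]
    have hEn := energy_eq_ofReal (v := r • T.meanFun v) (g := r • σ) hκ hV0 (hσ2.const_smul r)
      (by simpa only [Pi.smul_apply, smul_eq_mul] using hVint.1)
      (by simpa only [Pi.smul_apply, smul_eq_mul] using h4int.1)
    simp only [Pi.smul_apply (M := fun _ => ℝ), smul_eq_mul] at hEn
    rw [hVint.2, h4int.2, hσr] at hEn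
    have hle : Eh ≤ 1 / 2 * (r ^ 2 * ∫ x in Ω, ‖σ x‖ ^ 2) +
        1 / 2 * (∑ s ∈ T.elements, V₀ s * (r * SimplicialMesh.mean v s) ^ 2 *
          volume.real (SimplicialMesh.simplex s)) +
        κ / 4 * ∑ s ∈ T.elements, (r * SimplicialMesh.mean v s) ^ 4 *
          volume.real (SimplicialMesh.simplex s) := by
      refine ENNReal.toReal_le_of_le_ofReal ?_ ?_
      · have h1 : 0 ≤ ∑ s ∈ T.elements, V₀ s * (r * SimplicialMesh.mean v s) ^ 2 *
            volume.real (SimplicialMesh.simplex s) := Finset.sum_nonneg fun s hs =>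
          mul_nonneg (mul_nonneg (hV₀0 s hs) (sq_nonneg _)) measureReal_nonneg
        have h2 : 0 ≤ ∫ x in Ω, ‖σ x‖ ^ 2 := integral_nonneg fun x => sq_nonneg _
        positivity
      · rw [← hEn]
        exact iInf₂_le_of_le (r • T.meanFun v) (r • σ)
          (iInf₂_le_of_le hwpc (hσ.const_smul r) (iInf_le _ hwn))
    have hs2 : ∑ s ∈ T.elements, V₀ s * (r * SimplicialMesh.mean v s) ^ 2 *
          volume.real (SimplicialMesh.simplex s) =
        r ^ 2 * ∑ s ∈ T.elements, V₀ s * A s ^ 2 * m s := by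
      rw [Finset.mul_sum]
      exact Finset.sum_congr rfl fun s _ => by simp only [A, m]; ring
    have hs4 : ∑ s ∈ T.elements, (r * SimplicialMesh.mean v s) ^ 4 *
          volume.real (SimplicialMesh.simplex s) = r ^ 4 * ∑ s ∈ T.elements, A s ^ 4 * m s := by
      rw [Finset.mul_sum]
      exact Finset.sum_congr rfl fun s _ => by simp only [A, m]; ring
    rw [hs2, hs4] at hle
    have hr2' : 0 ≤ r ^ 2 := sq_nonneg r
    have hr4' : 0 ≤ r ^ 4 := by positivity
    have b1 : r ^ 2 * ∫ x in Ω, ‖σ x‖ ^ 2 ≤ r ^ 4 * G :=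
      (mul_le_mul_of_nonneg_left hσg hr2').trans (mul_le_mul_of_nonneg_right hrle hG0)
    have b2 : r ^ 2 * ∑ s ∈ T.elements, V₀ s * A s ^ 2 * m s ≤ r ^ 4 * P :=
      (mul_le_mul_of_nonneg_left hPV hr2').trans (mul_le_mul_of_nonneg_right hrle hP0)
    have b3 : κ / 4 * (r ^ 4 * ∑ s ∈ T.elements, A s ^ 4 * m s) ≤ κ / 4 * (r ^ 4 * Q) :=
      mul_le_mul_of_nonneg_left (mul_le_mul_of_nonneg_left hQ4 hr4') (by positivity)
    have hfin : Eh ≤ (t ^ 2)⁻¹ * e := by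
      rw [← hr4, heq]
      linarith
    rw [← div_eq_inv_mul, le_div_iff₀ (by positivity)] at hfin
    exact hfin
  have he0 : 0 ≤ e := ENNReal.toReal_nonneg
  -- The kinetic term is `G / 2`; this `2`, doubled by squaring `1 - q`, is the constant `4` of the
  -- theorem.
  have hG2 : G ≤ 2 * e := by
    rw [heq]
    have : 0 ≤ κ / 4 * Q := by positivity
    linarith
  set q := 2 * T.meshSize ^ 2 * (Real.pi ^ 2)⁻¹ * e
  have hq0 : 0 ≤ q := by positivity
  have hqt : 1 - q ≤ t := by
    refine le_trans ?_ htG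
    have h1 : 0 ≤ T.meshSize ^ 2 / Real.pi ^ 2 := by positivity
    have h2 := mul_le_mul_of_nonneg_left hG2 h1
    have h3 : T.meshSize ^ 2 / Real.pi ^ 2 * (2 * e) = q := by
      simp only [q]; rw [div_eq_mul_inv]; ring
    linarith
  have h2q : 4 * T.meshSize ^ 2 * (Real.pi ^ 2)⁻¹ * e = 2 * q := by simp only [q]; ring
  rw [h2q]
  -- For `q ≥ 1` the left side is nonpositive; otherwise `t² ≥ (1 - q)² ≥ 1 - 2q`.
  rcases le_total 1 q with h1 | h1
  · nlinarith
  · have h3 : 1 - 2 * q ≤ t ^ 2 := by nlinarith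
    exact (mul_le_mul_of_nonneg_left h3 hEh).trans hEt

/-! ### Admissible functions of finite energy. -/

lemma IsTestFunction.isWeakGradient {φ : Space d → ℝ} (hφ : IsTestFunction Ω φ) :
    IsWeakGradient Ω φ (gradient φ) := by
  refine ⟨hφ.memLp Ω, hφ.memLp_gradient Ω, fun ψ hψ => ?_⟩
  have hφc := hφ.1.continuous
  have hψc := hψ.1.continuous
  have hφg := hφ.continuous_gradient
  have hψg := hψ.continuous_gradient
  have hφd := hφ.1.continuous_fderiv (by simp)
  have hψd := hψ.1.continuous_fderiv (by simp)
  have hI1 : Integrable fun x => φ x • gradient ψ x :=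
    (hφc.smul hψg).integrable_of_hasCompactSupport hφ.2.1.smul_right
  have hI2 : Integrable fun x => ψ x • gradient φ x :=
    (hψc.smul hφg).integrable_of_hasCompactSupport hψ.2.1.smul_right
  have hz : ∀ x, x ∉ Ω → φ x = 0 := fun x hx =>
    image_eq_zero_of_notMem_tsupport fun h => hx (hφ.2.2 h)
  have hz' : ∀ x, x ∉ Ω → ψ x = 0 := fun x hx =>
    image_eq_zero_of_notMem_tsupport fun h => hx (hψ.2.2 h)
  rw [setIntegral_eq_integral_of_forall_compl_eq_zero (fun x hx => by rw [hz x hx, zero_smul]),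
    setIntegral_eq_integral_of_forall_compl_eq_zero (fun x hx => by rw [hz' x hx, zero_smul])]
  refine ext_inner_left ℝ fun z => ?_
  rw [inner_neg_right, ← integral_inner hI1, ← integral_inner hI2]
  have hin : ∀ (χ : Space d → ℝ) x, inner ℝ z (gradient χ x) = fderiv ℝ χ x z := fun χ x => by
    rw [real_inner_comm, inner_gradient_left]
  simp only [inner_smul_right, hin]
  have h1 := integral_mul_fderiv_eq_neg_fderiv_mul_of_integrable (μ := (volume : Measure (Space d)))
    (f := φ) (g := ψ) (v := z)
    (Continuous.integrable_of_hasCompactSupport (by fun_prop) hψ.2.1.mul_left)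
    (Continuous.integrable_of_hasCompactSupport (by fun_prop) hφ.2.1.mul_right)
    (Continuous.integrable_of_hasCompactSupport (by fun_prop) hφ.2.1.mul_right)
    (fun x _ => hφ.1.differentiable (by simp) x) (fun x _ => hψ.1.differentiable (by simp) x)
  simp only [mul_comm (ψ _)]
  exact h1

lemma IsTestFunction.memH10 {φ : Space d → ℝ} (hφ : IsTestFunction Ω φ) :
    MemH10 Ω φ (gradient φ) :=
  ⟨hφ.isWeakGradient, fun _ => φ, fun _ => hφ, by simp, by simp⟩

/-- There is an admissible function of finite energy. -/
lemma exists_energy_ne_top (hΩ : IsOpen Ω) (hne : Ω.Nonempty) {V : Space d → ℝ}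
    (hV : MemLp V ∞ (volume.restrict Ω)) (hV0 : ∀ᵐ x ∂(volume.restrict Ω), 0 ≤ V x)
    {κ : ℝ} (hκ : 0 < κ) : ∃ v g, MemH10 Ω v g ∧ eLpNorm v 2 (volume.restrict Ω) = 1 ∧
      energy Ω V κ v g ≠ ⊤ := by
  obtain ⟨x₀, hx₀⟩ := hne
  obtain ⟨f, hfs, hfc, hf, -, hfx⟩ := exists_contDiff_tsupport_subset (n := ⊤) (hΩ.mem_nhds hx₀)
  have hft : IsTestFunction Ω f := ⟨hf, hfc, hfs⟩
  have hfLp := hft.memLp Ω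
  set a := (eLpNorm f 2 (volume.restrict Ω)).toReal
  -- A continuous function vanishing almost everywhere vanishes identically, contrary to its value
  -- at `x₀`.
  have ha : a ≠ 0 := by
    intro h0
    have h1 := (ENNReal.toReal_eq_zero_iff _).1 h0
    rcases h1 with h1 | h1
    · rw [eLpNorm_eq_zero_iff hfLp.1 (by norm_num), EventuallyEq,
        ae_restrict_iff' hΩ.measurableSet] at h1
      have h2 : f =ᵐ[volume] 0 := by
        filter_upwards [h1] with x hx
        by_cases hxΩ : x ∈ Ω
        · exact hx hxΩ
        · exact image_eq_zero_of_notMem_tsupport fun h => hxΩ (hfs h)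
      have h3 := (Continuous.ae_eq_iff_eq volume hf.continuous continuous_zero).1 h2
      rw [h3] at hfx
      simp at hfx
    · exact hfLp.2.ne h1
  have ha0 : 0 < a := lt_of_le_of_ne ENNReal.toReal_nonneg ha.symm
  set φ : Space d → ℝ := a⁻¹ • f
  have hφ : IsTestFunction Ω φ := by
    refine ⟨contDiff_const.smul hf, hfc.smul_left (f := fun _ => a⁻¹), ?_⟩
    exact (tsupport_smul_subset_right (fun _ => a⁻¹) f).trans hfs
  have hφc := hφ.1.continuous
  refine ⟨φ, gradient φ, hφ.memH10, ?_, ?_⟩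
  · rw [eLpNorm_const_smul, ← ENNReal.ofReal_toReal hfLp.2.ne, Real.enorm_eq_ofReal (by positivity),
      ← ENNReal.ofReal_mul (by positivity)]
    change ENNReal.ofReal (a⁻¹ * a) = 1
    rw [inv_mul_cancel₀ ha, ENNReal.ofReal_one]
  · have hφ4 : IntegrableOn (fun x => φ x ^ 4) Ω := by
      refine (Continuous.integrable_of_hasCompactSupport (by fun_prop) ?_).integrableOn
      exact hφ.2.1.comp_left (g := fun z : ℝ => z ^ 4) (by simp)
    have hVφ : IntegrableOn (fun x => V x * φ x ^ 2) Ω := by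
      have h2 : MemLp (fun x => φ x ^ 2) 1 (volume.restrict Ω) :=
        memLp_one_iff_integrable.2 (hφ.memLp Ω).integrable_sq
      exact memLp_one_iff_integrable.1 (h2.mul hV)
    rw [energy_eq_ofReal hκ hV0 (hφ.memLp_gradient Ω) hVφ hφ4]
    exact ENNReal.ofReal_ne_top

end GrossPitaevskii

/-! ### The lower bound. -/

theorem theorem3p1 {d : ℕ} (hd_pos : 1 ≤ d) (hd_le : d ≤ 3)
    (Ω : Set (GrossPitaevskii.Space d))
    (hΩ_open : IsOpen Ω) (hΩ_convex : Convex ℝ Ω) (hΩ_nonempty : Ω.Nonempty)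
    (T : GrossPitaevskii.SimplicialMesh Ω)
    (V : GrossPitaevskii.Space d → ℝ)
    (hV_bdd : MemLp V ∞ (volume.restrict Ω))
    (hV_nonneg : ∀ᵐ x ∂(volume.restrict Ω), 0 ≤ V x)
    (hV_const : T.IsPiecewiseConstant V)
    (κ : ℝ) (hκ : 0 < κ) :
    T.discreteGroundStateEnergy V κ /
        (1 + 4 * T.meshSize ^ 2 * (Real.pi ^ 2)⁻¹ * T.discreteGroundStateEnergy V κ) ≤
      GrossPitaevskii.groundStateEnergy Ω V κ := by
  obtain ⟨v₀, g₀, hv₀, hn₀, he₀⟩ :=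
    GrossPitaevskii.exists_energy_ne_top hΩ_open hΩ_nonempty hV_bdd hV_nonneg hκ
  have hE : 0 ≤ T.discreteGroundStateEnergy V κ := ENNReal.toReal_nonneg
  unfold GrossPitaevskii.groundStateEnergy
  -- As `toReal` sends `⊤` to `0`, the infimum must be shown finite; the admissible pair `v₀`, `g₀`
  -- does this.
  rw [← ENNReal.ofReal_le_iff_le_toReal]
  · refine le_iInf₂ fun v g => le_iInf₂ fun hv hn => ?_
    by_cases he : GrossPitaevskii.energy Ω V κ v g = ⊤
    · rw [he]; exact le_top
    rw [ENNReal.ofReal_le_iff_le_toReal he, div_le_iff₀ (by positivity)]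
    have key := GrossPitaevskii.discreteGroundStateEnergy_mul_le hd_pos hd_le hΩ_open hΩ_convex
      hΩ_nonempty T hV_bdd.1 hV_nonneg hV_const hκ hv hn he
    -- The estimate is affine in the energy of `v`; moving the product term to the right gives the
    -- quotient form.
    linarith
  · refine ne_top_of_le_ne_top he₀ ?_
    exact iInf₂_le_of_le v₀ g₀ (iInf₂_le_of_le hv₀ hn₀ le_rfl)
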